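/- Let $\Sigma$ be a nonempty finite alphabet. A \emph{transition system} over $\Sigma$ consists of a finite set $Q$ of states, a total transition function $Q\times\Sigma\to Q$ and an initial state; $\mathcal T(u)$ denotes the state reached from the initial state by the finite word $u$. A deterministic automaton is a transition system with a set $F$ of final states; read as a deterministic Büchi automaton, it accepts $w\in\Sigma^\omega$ if its run on $w$ visits $F$ infinitely often. A \emph{strongly connected component} is a nonempty inclusion-maximal set $S$ of states such that for all $p,q\in S$ some nonempty word leads from $p$ to $q$; the automaton is \emph{weak} if each strongly connected component is contained in $F$ or disjoint from $F$. A \emph{family of deterministic weak automata} (FDWA) $\mathcal W=(\mathcal T,\mathcal B)$ consists of a transition system $\mathcal T$ over $\Sigma$ and, for each state $q$ of $\mathcal T$, a weak deterministic Büchi automaton $\mathcal B_q$ over $\Sigma$. A pair $(u,x)\in\Sigma^*\times\Sigma^+$ is \emph{accepted} by $\mathcal W$ if $\mathcal B_{\mathcal T(u)}$ accepts $x^\omega$, and it is \emph{normalized} if $\mathcal T(ux)=\mathcal T(u)$. The FDWA $\mathcal W$ is \emph{saturated} if for all normalized pairs $(u,x),(v,y)$ with $ux^\omega=vy^\omega$,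 $\mathcal W$ accepts $(u,x)$ if and only if it accepts $(v,y)$. Theorem. There is a deterministic Turing machine which, given (an explicit table encoding of) an alphabet $\Sigma$ and an FDWA $\mathcal W$ over $\Sigma$, decides in time polynomial in the length of the encoding whether $\mathcal W$ is saturated. -/

import Mathlib

/-- A deterministic complete transition system with input alphabet `A` and state set `Q`. -/
structure TransitionSystem (A Q : Type) where
  step : Q → A → Q
  start : Q

/-- The state reached from the initial state by reading the finite word `u`. -/
def TransitionSystem.eval {A Q : Type} (T : TransitionSystem A Q) (u : List A) : Q :=
  u.foldl T.step T.start

namespace DFA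

variable {A Q : Type}

/-- Acceptance of an `ω`-word by an automaton read as a deterministic Büchi automaton:
the run visits a final state infinitely often. -/
def BuchiAccepts (M : DFA A Q) (w : Stream' A) : Prop :=
  ∃ᶠ i in Filter.atTop, M.eval (w.take i) ∈ M.accept

/-- Any state of `S` is reachable from any state of `S` by a nonempty word. -/
def StronglyConnected (M : DFA A Q) (S : Set Q) : Prop :=
  ∀ p ∈ S, ∀ q ∈ S, ∃ x : List A, x ≠ [] ∧ M.evalFrom p x = q

/-- Strongly connected components: nonempty maximal strongly connected sets of states. -/
def IsSCC (M : DFA A Q) (S : Set Q) : Prop :=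
  S.Nonempty ∧ Maximal M.StronglyConnected S

/-- Weakness: every strongly connected component is completely accepting or completely
rejecting. -/
def IsWeak (M : DFA A Q) : Prop :=
  ∀ S : Set Q, M.IsSCC S → (∀ q ∈ S, q ∈ M.accept) ∨ (∀ q ∈ S, q ∉ M.accept)

end DFA

/-- A family of automata: a leading transition system with state set `Q`, and for each of its
states `q` a progress automaton with state set `P q`. -/
structure AutomataFamily (A Q : Type) (P : Q → Type) where
  leading : TransitionSystem A Q
  progress : ∀ q : Q, DFA A (P q)

namespace AutomataFamily

variable {A Q : Type} {P : Q → Type}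

/-- The pair `(u, x)` is normalized: `ux` and `u` lead to the same leading state. -/
def Normalized (F : AutomataFamily A Q P) (u x : List A) : Prop :=
  F.leading.eval (u ++ x) = F.leading.eval u

/-- The pair `(u, x)` is accepted in the `ω`-semantics: the progress automaton of the leading
state reached by `u`, read as a Büchi automaton, accepts `x^ω`. -/
def OmegaAccepts (F : AutomataFamily A Q P) (u x : List A) (hx : x ≠ []) : Prop :=
  (F.progress (F.leading.eval u)).BuchiAccepts (Stream'.cycle x hx)

/-- Saturation in the `ω`-semantics: any two normalized pairs representing the same ultimately
periodic word are both accepted or both rejected. -/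
def OmegaSaturated (F : AutomataFamily A Q P) : Prop :=
  ∀ (u x v y : List A) (hx : x ≠ []) (hy : y ≠ []), F.Normalized u x → F.Normalized v y →
    Stream'.appendStream' u (Stream'.cycle x hx) = Stream'.appendStream' v (Stream'.cycle y hy) →
    (F.OmegaAccepts u x hx ↔ F.OmegaAccepts v y hy)

end AutomataFamily

/-- A finitely presented family of deterministic weak automata: a nonempty finite alphabet, a
finite leading transition system and finite weak progress automata, all with numbered letters
and states. The alphabet and the numbers of states are part of the data. -/
structure FDWA where
  letters : ℕ
  letters_pos : 0 < letters
  leadingSize : ℕ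
  progressSize : Fin leadingSize → ℕ
  family : AutomataFamily (Fin letters) (Fin leadingSize) (fun q => Fin (progressSize q))
  weak : ∀ q, (family.progress q).IsWeak

namespace FDWA

/-- An FDWA is saturated if its underlying family is, for the `ω`-semantics. -/
def Saturated (W : FDWA) : Prop :=
  W.family.OmegaSaturated

open Classical in
/-- The description of one progress automaton: number of states, initial state, transition
table row by row, and one bit per state for acceptance. -/
noncomputable def progressNumbers {m k : ℕ} (M : DFA (Fin m) (Fin k)) : List ℕ :=
  k :: M.start.val ::
    ((List.finRange k).flatMap fun s => (List.finRange m).map fun a => (M.step s a).val) ++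
    (List.finRange k).map fun s => if s ∈ M.accept then 1 else 0

/-- The description of an FDWA: number of letters, number of leading states, initial leading
state, leading transition table row by row, then the progress automata one after another. -/
noncomputable def numbers (W : FDWA) : List ℕ :=
  W.letters :: W.leadingSize :: W.family.leading.start.val ::
    ((List.finRange W.leadingSize).flatMap fun q =>
      (List.finRange W.letters).map fun a => (W.family.leading.step q a).val) ++
    (List.finRange W.leadingSize).flatMap fun q => progressNumbers (W.family.progress q)

/-- The input word describing an FDWA: its list of numbers, each number `j` being written as
`j` times `true` followed by `false`. Since all states are listed in the tables, the length of
this word is polynomial in the number of letters, the number of leading states and the maximal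
number of states of a progress automaton. -/
noncomputable def encode (W : FDWA) : List Bool :=
  W.numbers.flatMap fun j => List.replicate j true ++ [false]

end FDWA

/-! Saturation fails exactly if a single rotation of a period can change the verdict. If `(u, x)`
and `(v, y)` are normalized pairs for the same word `w`, each can be shifted along `w` letter by
letter: at position `j` the progress automaton of the leading state reached by `w.take j` reads
`w.drop j`. At position `max u.length v.length` both pairs pose the same question. So if no single
shift changes acceptance, `W` is saturated (`AutomataFamily.omegaSaturated_iff`).

A failing shift leaves a witness of bounded dimension. Replacing the period by a suitable power does
not change the periodic word and makes both automata involved, that of `q` and that of its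
`a`-successor, return after each round to the state reached after the first. By weakness the verdict
is then the finality of this state (`DFA.IsWeak.buchiAccepts_iff`), since all states visited later
lie on a cycle with it. The witness is an unstable loop: a reachable `q`, a letter `a`, a word `z`
and two looping states `s`, `r` that differ in finality. The length of `z` is unbounded, but `q`,
`a`, `s`, `r` can be guessed and `z` read letter by letter while only five current states are
tracked: the leading state, and two copies of each progress automaton, one started in its initial
state and one in the guessed looping state. This is reachability in a graph whose nodes are ten
numbers below the input length `L`, so `L ^ 10` rounds of a backward search suffice
(`FDWA.saturated_iff`).

For the time bound, one round of the search is written as an arithmetical expression over the input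
table and the table of nodes found so far. Expressions use only bounded sums and capped iterations,
so they compile to stack programs of polynomial cost (`Expr.run_compile`). Iterating a round
preserves this bound because the table always consists of at most `L ^ 10` bits (`Run.solve`). Stack
programs are simulated by machines with one machine step per unit of cost (`Exec.stepsTo`). -/

/-! ### Structured programs on stacks of unary numbers -/

namespace StackProgram

/-- The stacks of the machine: environment, input table, bit table, results, and three
auxiliary stacks. -/
inductive Stack
  | env | mem | vis | res | tmp | cnt | out
  deriving DecidableEq

instance : Fintype Stack where
  elems := {.env, .mem, .vis, .res, .tmp, .cnt, .out}
  complete := by intro k; cases k <;> decide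

/-- The contents of all stacks, each a list of numbers with the top first. -/
structure State where
  env : List ℕ := []
  mem : List ℕ := []
  vis : List ℕ := []
  res : List ℕ := []
  tmp : List ℕ := []
  cnt : List ℕ := []
  out : List ℕ := []

/-- The contents of one stack. -/
def State.get (s : State) : Stack → List ℕ
  | .env => s.env
  | .mem => s.mem
  | .vis => s.vis
  | .res => s.res
  | .tmp => s.tmp
  | .cnt => s.cnt
  | .out => s.out

/-- Overwriting one stack. -/
def State.set (s : State) : Stack → List ℕ → State
  | .env, l => { s with env := l }
  | .mem, l => { s with mem := l }
  | .vis, l => { s with vis := l }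
  | .res, l => { s with res := l }
  | .tmp, l => { s with tmp := l }
  | .cnt, l => { s with cnt := l }
  | .out, l => { s with out := l }

@[simp] theorem State.get_set_self (s : State) (k : Stack) (l : List ℕ) :
    (s.set k l).get k = l := by
  cases k <;> rfl

theorem State.get_set_of_ne (s : State) {j k : Stack} (h : j ≠ k) (l : List ℕ) :
    (s.set k l).get j = s.get j := by
  cases k <;> cases j <;> first | rfl | exact absurd rfl h

@[simp] theorem State.set_set (s : State) (k : Stack) (l l' : List ℕ) :
    (s.set k l).set k l' = s.set k l' := by
  cases k <;> rfl

@[simp] theorem State.set_get (s : State) (k : Stack) : s.set k (s.get k) = s := by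
  cases k <;> rfl

theorem State.set_comm (s : State) {j k : Stack} (h : j ≠ k) (l l' : List ℕ) :
    (s.set k l).set j l' = (s.set j l').set k l := by
  cases k <;> cases j <;> first | rfl | exact absurd rfl h

/-- Structured programs. `loop k p` removes the top number `n` of the stack `k` and runs `p` as
many times; during the runs the number of outstanding ones is on top of `k`. -/
inductive Prog
  | skip : Prog
  | zero (k : Stack) : Prog
  | inc (k : Stack) : Prog
  | seq (p q : Prog) : Prog
  | loop (k : Stack) (p : Prog) : Prog
  | ifNonempty (k : Stack) (p q : Prog) : Prog
  | whileNonempty (k : Stack) (p : Prog) : Prog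

/-- Big-step semantics: `Exec p s t s'` says that `p` leads from `s` to `s'` in `t` steps. -/
inductive Exec : Prog → State → ℕ → State → Prop
  | skip (s : State) : Exec .skip s 1 s
  | zero (k : Stack) (s : State) : Exec (.zero k) s 1 (s.set k (0 :: s.get k))
  | inc {k : Stack} {s : State} {n : ℕ} {l : List ℕ} (h : s.get k = n :: l) :
      Exec (.inc k) s 1 (s.set k ((n + 1) :: l))
  | seq {p q : Prog} {s s' s'' : State} {t t' : ℕ} (h : Exec p s t s') (h' : Exec q s' t' s'') :
      Exec (.seq p q) s (t + t') s''
  | loop_zero {k : Stack} (p : Prog) {s : State} {l : List ℕ} (h : s.get k = 0 :: l) :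
      Exec (.loop k p) s 1 (s.set k l)
  | loop_succ {k : Stack} {p : Prog} {s s' s'' : State} {t t' n : ℕ} {l : List ℕ}
      (h : s.get k = (n + 1) :: l) (hp : Exec p (s.set k (n :: l)) t s')
      (hl : Exec (.loop k p) s' t' s'') : Exec (.loop k p) s (1 + t + t') s''
  | ifNonempty_pos {k : Stack} {p : Prog} (q : Prog) {s s' : State} {t : ℕ} (h : s.get k ≠ [])
      (hp : Exec p s t s') : Exec (.ifNonempty k p q) s (1 + t) s'
  | ifNonempty_neg {k : Stack} (p : Prog) {q : Prog} {s s' : State} {t : ℕ} (h : s.get k = [])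
      (hq : Exec q s t s') : Exec (.ifNonempty k p q) s (1 + t) s'
  | while_nil {k : Stack} (p : Prog) {s : State} (h : s.get k = []) :
      Exec (.whileNonempty k p) s 1 s
  | while_cons {k : Stack} {p : Prog} {s s' s'' : State} {t t' : ℕ} (h : s.get k ≠ [])
      (hp : Exec p s t s') (hl : Exec (.whileNonempty k p) s' t' s'') :
      Exec (.whileNonempty k p) s (1 + t + t') s''

/-! ### Compilation to machines with stacks of bits -/

/-- Unary representation of lists of numbers. -/
def unary (l : List ℕ) : List Bool := l.flatMap fun j => List.replicate j true ++ [false]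

@[simp] theorem unary_nil : unary [] = [] := rfl

@[simp] theorem unary_zero_cons (l : List ℕ) : unary (0 :: l) = false :: unary l := rfl

@[simp] theorem unary_succ_cons (n : ℕ) (l : List ℕ) :
    unary ((n + 1) :: l) = true :: unary (n :: l) := rfl

/-- The bits on the stacks. -/
def State.bits (s : State) (k : Stack) : List Bool := unary (s.get k)

theorem State.bits_set (s : State) (k : Stack) (l : List ℕ) :
    (s.set k l).bits = Function.update s.bits k (unary l) := by
  funext j
  by_cases h : j = k
  · subst h; simp [State.bits]
  · simp [State.bits, h, State.get_set_of_ne]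

/-- Every number, even `0`, contributes a closing `false`, so a peek at the bits detects whether a
number is present. -/
theorem State.head?_bits_isSome {s : State} {k : Stack} :
    (s.bits k).head?.isSome ↔ s.get k ≠ [] := by
  unfold State.bits
  rcases s.get k with _ | ⟨_ | n, l⟩ <;> simp

/-- The program points of a program. -/
def Prog.Label : Prog → Type
  | .skip => Unit
  | .zero _ => Unit
  | .inc _ => Unit
  | .seq p q => p.Label ⊕ q.Label
  | .loop _ p => Option p.Label
  | .ifNonempty _ p q => Option (p.Label ⊕ q.Label)
  | .whileNonempty _ p => Option p.Label

/-- A program has finitely many program points. -/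
@[reducible] def Prog.fintypeLabel : (p : Prog) → Fintype p.Label
  | .skip => inferInstanceAs (Fintype Unit)
  | .zero _ => inferInstanceAs (Fintype Unit)
  | .inc _ => inferInstanceAs (Fintype Unit)
  | .seq p q => @instFintypeSum _ _ p.fintypeLabel q.fintypeLabel
  | .loop _ p => @instFintypeOption _ p.fintypeLabel
  | .ifNonempty _ p q =>
      @instFintypeOption _ (@instFintypeSum _ _ p.fintypeLabel q.fintypeLabel)
  | .whileNonempty _ p => @instFintypeOption _ p.fintypeLabel

/-- The program point at which the execution of a program starts. -/
def Prog.entry : (p : Prog) → p.Label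
  | .skip => ()
  | .zero _ => ()
  | .inc _ => ()
  | .seq p _ => Sum.inl p.entry
  | .loop _ _ => none
  | .ifNonempty _ _ _ => none
  | .whileNonempty _ _ => none

open Turing.TM2 (Stmt)

/-- The machine code of a program whose program points are embedded into a type of labels by `f`
and which continues at the label `e` when it is finished. -/
def Prog.code {L : Type} : (p : Prog) → (f : p.Label → L) → (e : L) → p.Label →
    Stmt (fun _ : Stack => Bool) L (Option Bool)
  | .skip, _, e, _ => .goto fun _ => e
  | .zero k, _, e, _ => .push k (fun _ => false) (.goto fun _ => e)
  | .inc k, _, e, _ => .push k (fun _ => true) (.goto fun _ => e)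
  | .seq p q, f, e, l =>
      Sum.elim (p.code (fun i => f (Sum.inl i)) (f (Sum.inr q.entry)))
        (q.code (fun i => f (Sum.inr i)) e) l
  | .loop k p, f, e, l =>
      Option.elim l
        (.pop k (fun _ o => o) (.goto fun v => if v = some true then f (some p.entry) else e))
        (p.code (fun i => f (some i)) (f none))
  | .ifNonempty k p q, f, e, l =>
      Option.elim l
        (.peek k (fun _ o => o) (.goto fun v =>
          if v.isSome then f (some (Sum.inl p.entry)) else f (some (Sum.inr q.entry))))
        (Sum.elim (p.code (fun i => f (some (Sum.inl i))) e)
          (q.code (fun i => f (some (Sum.inr i))) e))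
  | .whileNonempty k p, f, e, l =>
      Option.elim l
        (.peek k (fun _ o => o) (.goto fun v => if v.isSome then f (some p.entry) else e))
        (p.code (fun i => f (some i)) (f none))

/-- A machine reaches the configuration `c'` from `c` in `t` steps. -/
def StepsTo {L : Type} (m : L → Stmt (fun _ : Stack => Bool) L (Option Bool))
    (t : ℕ) (c c' : Turing.TM2.Cfg (fun _ : Stack => Bool) L (Option Bool)) : Prop :=
  (flip bind (Turing.TM2.step m))^[t] (some c) = some c'

theorem StepsTo.trans {L : Type} {m : L → Stmt (fun _ : Stack => Bool) L (Option Bool)}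
    {t t' : ℕ} {c c' c'' : Turing.TM2.Cfg (fun _ : Stack => Bool) L (Option Bool)}
    (h : StepsTo m t c c') (h' : StepsTo m t' c' c'') : StepsTo m (t + t') c c'' := by
  unfold StepsTo at *
  rw [Nat.add_comm, Function.iterate_add_apply, h, h']

theorem StepsTo.single {L : Type} {m : L → Stmt (fun _ : Stack => Bool) L (Option Bool)}
    (l : L) (v : Option Bool) (S : Stack → List Bool) :
    StepsTo m 1 ⟨some l, v, S⟩ (Turing.TM2.stepAux (m l) v S) := rfl

/-- The embedding `f` and the exit label `e` are arbitrary, so that the induction hypotheses apply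
to subprograms inside a larger machine. The register may hold anything, because each test overwrites
it before branching. -/
theorem Exec.stepsTo {L : Type} {m : L → Stmt (fun _ : Stack => Bool) L (Option Bool)}
    {p : Prog} {s s' : State} {t : ℕ} (h : Exec p s t s') :
    ∀ (f : p.Label → L) (e : L), (∀ l, m (f l) = p.code f e l) → ∀ v : Option Bool,
      ∃ v', StepsTo m t ⟨some (f p.entry), v, s.bits⟩ ⟨some e, v', s'.bits⟩ := by
  induction h with
  | skip s =>
    intro f e hm v
    refine ⟨v, ?_⟩
    have := StepsTo.single (m := m) (f Prog.skip.entry) v s.bits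
    rw [hm] at this
    exact this
  | zero k s =>
    intro f e hm v
    refine ⟨v, ?_⟩
    have := StepsTo.single (m := m) (f (Prog.zero k).entry) v s.bits
    rw [hm] at this
    rw [State.bits_set]
    exact this
  | @inc k s n l h =>
    intro f e hm v
    refine ⟨v, ?_⟩
    have := StepsTo.single (m := m) (f (Prog.inc k).entry) v s.bits
    rw [hm] at this
    rw [State.bits_set, unary_succ_cons, ← h]
    exact this
  | @seq p q s s' s'' t t' h h' ih ih' =>
    intro f e hm v
    obtain ⟨v', hv'⟩ := ih (fun i => f (Sum.inl i)) (f (Sum.inr q.entry))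
      (fun l => hm (Sum.inl l)) v
    obtain ⟨v'', hv''⟩ := ih' (fun i => f (Sum.inr i)) e (fun l => hm (Sum.inr l)) v'
    exact ⟨v'', hv'.trans hv''⟩
  | @loop_zero k p s l h =>
    intro f e hm v
    refine ⟨some false, ?_⟩
    have := StepsTo.single (m := m) (f none) v s.bits
    rw [hm none] at this
    have hb : s.bits k = false :: unary l := by rw [State.bits, h, unary_zero_cons]
    change StepsTo m 1 ⟨some (f none), v, s.bits⟩ _
    simpa [Prog.code, hb, State.bits_set] using this
  | @loop_succ k p s s' s'' t t' n l h hp hl ih ih' =>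
    intro f e hm v
    have h1 := StepsTo.single (m := m) (f none) v s.bits
    rw [hm none] at h1
    have hb : s.bits k = true :: unary (n :: l) := by rw [State.bits, h, unary_succ_cons]
    replace h1 : StepsTo m 1 ⟨some (f none), v, s.bits⟩
        ⟨some (f (some p.entry)), some true, (s.set k (n :: l)).bits⟩ := by
      simpa [Prog.code, hb, State.bits_set] using h1
    obtain ⟨v', hv'⟩ := ih (fun i => f (some i)) (f none) (fun l => hm (some l)) (some true)
    obtain ⟨v'', hv''⟩ := ih' f e hm v'
    exact ⟨v'', (h1.trans hv').trans hv''⟩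
  | @ifNonempty_pos k p q s s' t h hp ih =>
    intro f e hm v
    have h1 := StepsTo.single (m := m) (f none) v s.bits
    rw [hm none] at h1
    have hb := State.head?_bits_isSome.2 h
    replace h1 : StepsTo m 1 ⟨some (f none), v, s.bits⟩
        ⟨some (f (some (Sum.inl p.entry))), (s.bits k).head?, s.bits⟩ := by
      simpa [Prog.code, hb] using h1
    obtain ⟨v', hv'⟩ := ih (fun i => f (some (Sum.inl i))) e (fun l => hm (some (Sum.inl l)))
      (s.bits k).head?
    exact ⟨v', h1.trans hv'⟩
  | @ifNonempty_neg k p q s s' t h hp ih =>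
    intro f e hm v
    have h1 := StepsTo.single (m := m) (f none) v s.bits
    rw [hm none] at h1
    have hb : s.bits k = [] := by rw [State.bits, h, unary_nil]
    replace h1 : StepsTo m 1 ⟨some (f none), v, s.bits⟩
        ⟨some (f (some (Sum.inr q.entry))), none, s.bits⟩ := by
      simpa [Prog.code, hb] using h1
    obtain ⟨v', hv'⟩ := ih (fun i => f (some (Sum.inr i))) e (fun l => hm (some (Sum.inr l)))
      none
    exact ⟨v', h1.trans hv'⟩
  | @while_nil k p s h =>
    intro f e hm v
    refine ⟨none, ?_⟩
    have := StepsTo.single (m := m) (f none) v s.bits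
    rw [hm none] at this
    have hb : s.bits k = [] := by rw [State.bits, h, unary_nil]
    change StepsTo m 1 ⟨some (f none), v, s.bits⟩ _
    simpa [Prog.code, hb] using this
  | @while_cons k p s s' s'' t t' h hp hl ih ih' =>
    intro f e hm v
    have h1 := StepsTo.single (m := m) (f none) v s.bits
    rw [hm none] at h1
    have hb := State.head?_bits_isSome.2 h
    replace h1 : StepsTo m 1 ⟨some (f none), v, s.bits⟩
        ⟨some (f (some p.entry)), (s.bits k).head?, s.bits⟩ := by
      simpa [Prog.code, hb] using h1
    obtain ⟨v', hv'⟩ := ih (fun i => f (some i)) (f none) (fun l => hm (some l))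
      (s.bits k).head?
    obtain ⟨v'', hv''⟩ := ih' f e hm v'
    exact ⟨v'', (h1.trans hv').trans hv''⟩

/-- The machine that runs a program and then replaces the number `1` or `0` left on the stack of
results by a bit. -/
def Prog.machine (p : Prog) : Turing.FinTM2 where
  K := Stack
  k₀ := .mem
  k₁ := .res
  Γ := fun _ => Bool
  Λ := Option p.Label
  main := some p.entry
  ΛFin := @instFintypeOption _ p.fintypeLabel
  σ := Option Bool
  initialState := none
  Γk₀Fin := inferInstanceAs (Fintype Bool)
  m := fun l => Option.elim l
    (.pop .res (fun _ o => o) (.branch (fun v => v == some true)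
      (.pop .res (fun _ _ => none) (.push .res (fun _ => true) .halt))
      (.load (fun _ => none) (.push .res (fun _ => false) .halt))))
    (p.code some none)

/-- `Run p s s' t` says that `p` leads from `s` to `s'` in at most `t` steps. -/
def Run (p : Prog) (s s' : State) (t : ℕ) : Prop := ∃ t' ≤ t, Exec p s t' s'

/-- A function is computable in polynomial time if some program computes it in polynomial time,
the inputs being given as lists of numbers in unary representation. -/
theorem computableInPolyTime_of_run {α : Type} {ea : α → List Bool} {f : α → Bool} (p : Prog)
    (inp : α → List ℕ) (hinp : ∀ a, ea a = unary (inp a)) (time : Polynomial ℕ)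
    (hrun : ∀ a, Run p { mem := inp a } { res := [if f a then 1 else 0] }
      (time.eval (ea a).length)) :
    Nonempty (Turing.TM2ComputableInPolyTime ea Computability.encodeBool f) := by
  refine ⟨⟨⟨p.machine, Equiv.refl Bool, Equiv.refl Bool⟩, time + 1, fun a => ?_⟩⟩
  have key : ∃ t ≤ time.eval (ea a).length + 1,
      (flip bind p.machine.step)^[t] (some (Turing.initList p.machine (ea a))) =
        some (Turing.haltList p.machine [f a]) := by
    obtain ⟨t, ht, hex⟩ := hrun a
    obtain ⟨v, hv⟩ := Exec.stepsTo (m := p.machine.m) hex some none (fun _ => rfl) none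
    refine ⟨t + 1, by omega, ?_⟩
    -- The label `none` accounts for the additional step: the result, `true, false` for `1` or
    -- `false` for `0`, becomes a single bit, and the register is reset as `Turing.haltList`
    -- requires.
    have h2 := hv.trans (StepsTo.single none v _)
    have hi : Turing.initList p.machine (ea a) =
        ⟨some (some p.entry), none, State.bits { mem := inp a }⟩ := by
      unfold Turing.initList
      congr 1
      funext k
      rw [hinp]
      cases k <;> rfl
    rw [hi]
    refine Eq.trans h2 (congrArg some ?_)
    unfold Turing.haltList
    cases f a <;>
    · refine congrArg (Turing.TM2.Cfg.mk none none) ?_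
      funext k
      cases k <;> rfl
  have hmap : List.map (Equiv.refl Bool).invFun (ea a) = ea a := List.map_id _
  -- The number of steps is data in the structure to be built, so it has to be chosen.
  obtain ⟨t, ht, hstep⟩ := Classical.indefiniteDescription _ key
  refine ⟨⟨t, ?_⟩, ht.trans (by simp)⟩
  refine Eq.trans ?_ hstep
  exact congrArg (fun l => (flip bind p.machine.step)^[t] (some (Turing.initList p.machine l))) hmap

end StackProgram

namespace StackProgram

/-! ### Derived programs -/

theorem Run.mono {p : Prog} {s s' : State} {t t' : ℕ} (h : Run p s s' t) (ht : t ≤ t') :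
    Run p s s' t' :=
  let ⟨u, hu, he⟩ := h
  ⟨u, hu.trans ht, he⟩

theorem Run.skip (s : State) : Run .skip s s 1 := ⟨1, le_rfl, .skip s⟩

theorem Run.zero (k : Stack) (s : State) : Run (.zero k) s (s.set k (0 :: s.get k)) 1 :=
  ⟨1, le_rfl, .zero k s⟩

theorem Run.inc {k : Stack} {s : State} {n : ℕ} {l : List ℕ} (h : s.get k = n :: l) :
    Run (.inc k) s (s.set k ((n + 1) :: l)) 1 :=
  ⟨1, le_rfl, .inc h⟩

theorem Run.seq {p q : Prog} {s s' s'' : State} {t t' : ℕ} (h : Run p s s' t)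
    (h' : Run q s' s'' t') : Run (.seq p q) s s'' (t + t') :=
  let ⟨u, hu, he⟩ := h
  let ⟨u', hu', he'⟩ := h'
  ⟨u + u', add_le_add hu hu', .seq he he'⟩

theorem Run.ifNonempty_pos {k : Stack} {p : Prog} (q : Prog) {s s' : State} {t : ℕ}
    (h : s.get k ≠ []) (hp : Run p s s' t) : Run (.ifNonempty k p q) s s' (1 + t) :=
  let ⟨u, hu, he⟩ := hp
  ⟨1 + u, by omega, .ifNonempty_pos q h he⟩

theorem Run.ifNonempty_neg {k : Stack} (p : Prog) {q : Prog} {s s' : State} {t : ℕ}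
    (h : s.get k = []) (hq : Run q s s' t) : Run (.ifNonempty k p q) s s' (1 + t) :=
  let ⟨u, hu, he⟩ := hq
  ⟨1 + u, by omega, .ifNonempty_neg p h he⟩

/-- The rule for loops: `g n` describes the other stacks when `n` runs are outstanding. -/
theorem Run.loop {k : Stack} {p : Prog} (g : ℕ → State) (l : List ℕ) (t v : ℕ)
    (h : ∀ n < v, Run p ((g (n + 1)).set k (n :: l)) ((g n).set k (n :: l)) t) :
    Run (.loop k p) ((g v).set k (v :: l)) ((g 0).set k l) (v * (t + 1) + 1) := by
  induction v with
  | zero =>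
    refine ⟨1, by omega, ?_⟩
    have := Exec.loop_zero p (k := k) (s := (g 0).set k (0 :: l)) (l := l) (by simp)
    simpa using this
  | succ v ih =>
    obtain ⟨u, hu, he⟩ := ih fun n hn => h n (by omega)
    obtain ⟨u', hu', he'⟩ := h v (by omega)
    refine ⟨1 + u' + u, by rw [Nat.succ_mul]; omega, ?_⟩
    exact Exec.loop_succ (k := k) (s := (g (v + 1)).set k ((v + 1) :: l)) (n := v) (l := l)
      (by simp) (by simpa using he') he

theorem Run.while_nil {k : Stack} (p : Prog) {s : State} (h : s.get k = []) :
    Run (.whileNonempty k p) s s 1 :=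
  ⟨1, le_rfl, .while_nil p h⟩

theorem Run.while_cons {k : Stack} {p : Prog} {s s' s'' : State} {t t' : ℕ} (h : s.get k ≠ [])
    (hp : Run p s s' t) (hl : Run (.whileNonempty k p) s' s'' t') :
    Run (.whileNonempty k p) s s'' (1 + t + t') :=
  let ⟨u, hu, he⟩ := hp
  let ⟨u', hu', he'⟩ := hl
  ⟨1 + u + u', by omega, .while_cons h he he'⟩

/-- Removing the top number of a stack. -/
def Prog.drop (k : Stack) : Prog := .loop k .skip

theorem Run.drop {k : Stack} {s : State} {x : ℕ} {l : List ℕ} (h : s.get k = x :: l) :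
    Run (.drop k) s (s.set k l) (x * 2 + 1) := by
  have := Run.loop (k := k) (p := .skip) (fun _ => s) l 1 x fun n _ => Run.skip _
  rwa [← h, State.set_get] at this

/-- Moving the top number of a stack to another stack. -/
def Prog.move (j k : Stack) : Prog := .seq (.zero k) (.loop j (.inc k))

theorem Run.move {j k : Stack} {s : State} {x : ℕ} {l : List ℕ} (hjk : j ≠ k)
    (h : s.get j = x :: l) :
    Run (.move j k) s ((s.set j l).set k (x :: s.get k)) (x * 2 + 2) := by
  -- With `n` runs outstanding, `x - n` units have arrived. As loops count down, most invariants
  -- below contain such a difference.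
  have hloop := Run.loop (k := j) (p := .inc k) (fun n => s.set k ((x - n) :: s.get k)) l 1 x
    fun n hn => by
      have := Run.inc (k := k) (s := (s.set k ((x - (n + 1)) :: s.get k)).set j (n :: l))
        (n := x - (n + 1)) (l := s.get k) (by rw [State.get_set_of_ne _ hjk.symm]; simp)
      rw [State.set_comm _ hjk.symm, State.set_set] at this
      rwa [show x - (n + 1) + 1 = x - n by omega] at this
  have hz := Run.zero k s
  have := hz.seq (s'' := ((s.set j l).set k (x :: s.get k))) (t' := x * 2 + 1) (by
    rw [← h, Nat.sub_self, ← State.get_set_of_ne s hjk (0 :: s.get k), State.set_get,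
      Nat.sub_zero, State.set_comm _ hjk] at hloop
    exact hloop)
  exact this.mono (by omega)

/-- Replacing the two top results by their sum. -/
def Prog.addTop : Prog := .seq (.move .res .tmp) (.loop .tmp (.inc .res))

theorem Run.addTop (E M V R T C U : List ℕ) (x y : ℕ) :
    Run .addTop ⟨E, M, V, y :: x :: R, T, C, U⟩ ⟨E, M, V, (x + y) :: R, T, C, U⟩ (y * 4 + 3) := by
  have h1 := Run.move (j := .res) (k := .tmp) (s := ⟨E, M, V, y :: x :: R, T, C, U⟩)
    (by decide) rfl
  have h2 := Run.loop (k := .tmp) (p := .inc .res)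
    (fun n => ⟨E, M, V, (x + (y - n)) :: R, T, C, U⟩) T 1 y fun n hn => by
      have := Run.inc (k := .res) (s := ⟨E, M, V, (x + (y - (n + 1))) :: R, n :: T, C, U⟩) rfl
      rwa [show x + (y - (n + 1)) + 1 = x + (y - n) by omega] at this
  simp only [Nat.sub_self, Nat.sub_zero] at h2
  exact (h1.seq h2).mono (by omega)

/-- Decrementing the top result. -/
def Prog.dec : Prog :=
  .seq (.zero .tmp) (.seq (.loop .res (.seq (.loop .res (.inc .tmp)) (.zero .res)))
    (.move .tmp .res))

/-- The outer loop serves as a case distinction. On `0` it merely removes the number; on `x + 1` its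
body moves the `x` outstanding units to `tmp` and leaves `0`, so that it runs only once. -/
theorem Run.dec (E M V R T C U : List ℕ) (x : ℕ) :
    Run .dec ⟨E, M, V, x :: R, T, C, U⟩ ⟨E, M, V, (x - 1) :: R, T, C, U⟩ (x * 4 + 6) := by
  have h1 := Run.zero .tmp ⟨E, M, V, x :: R, T, C, U⟩
  have h3 := Run.move (j := .tmp) (k := .res) (s := ⟨E, M, V, R, (x - 1) :: T, C, U⟩)
    (by decide) rfl
  refine (h1.seq (Run.seq (s' := ⟨E, M, V, R, (x - 1) :: T, C, U⟩) (t := x * 2 + 2) ?_ h3)).mono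
    (t := 1 + (x * 2 + 2 + ((x - 1) * 2 + 2))) (by omega)
  cases x with
  | zero => exact ⟨1, by omega, Exec.loop_zero _ rfl⟩
  | succ x =>
    have h2 := Run.loop (k := .res) (p := .inc .tmp)
      (fun n => ⟨E, M, V, [], (x - n) :: T, C, U⟩) R 1 x fun n hn => by
        have := Run.inc (k := .tmp) (s := ⟨E, M, V, n :: R, (x - (n + 1)) :: T, C, U⟩) rfl
        rwa [show x - (n + 1) + 1 = x - n by omega] at this
    simp only [Nat.sub_self, Nat.sub_zero] at h2
    obtain ⟨t, ht, he⟩ := h2.seq (Run.zero .res _)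
    exact ⟨1 + t + 1, by omega, Exec.loop_succ (n := x) (l := R) rfl he (Exec.loop_zero _ rfl)⟩

/-- Replacing the two top results by their truncated difference. -/
def Prog.subTop : Prog := .seq (.move .res .tmp) (.loop .tmp .dec)

theorem Run.subTop (E M V R T C U : List ℕ) (x y : ℕ) :
    Run .subTop ⟨E, M, V, y :: x :: R, T, C, U⟩ ⟨E, M, V, (x - y) :: R, T, C, U⟩
      (y * 2 + 2 + (y * (x * 4 + 7) + 1)) := by
  have h1 := Run.move (j := .res) (k := .tmp) (s := ⟨E, M, V, y :: x :: R, T, C, U⟩)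
    (by decide) rfl
  have h2 := Run.loop (k := .tmp) (p := .dec)
    (fun n => ⟨E, M, V, (x - (y - n)) :: R, T, C, U⟩) T (x * 4 + 6) y fun n hn => by
      have := Run.dec E M V R (n :: T) C U (x - (y - (n + 1)))
      rw [show x - (y - (n + 1)) - 1 = x - (y - n) by omega] at this
      exact this.mono (by omega)
  simp only [Nat.sub_self, Nat.sub_zero] at h2
  exact h1.seq h2

/-- Duplicating the top result. -/
def Prog.dup : Prog :=
  .seq (.zero .tmp) (.seq (.zero .cnt) (.seq (.loop .res (.seq (.inc .tmp) (.inc .cnt)))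
    (.seq (.move .tmp .res) (.move .cnt .res))))

theorem Run.dup (E M V R T C U : List ℕ) (x : ℕ) :
    Run .dup ⟨E, M, V, x :: R, T, C, U⟩ ⟨E, M, V, x :: x :: R, T, C, U⟩ (x * 7 + 7) := by
  have h1 := Run.zero .tmp ⟨E, M, V, x :: R, T, C, U⟩
  have h2 := Run.zero .cnt ⟨E, M, V, x :: R, 0 :: T, C, U⟩
  have h3 := Run.loop (k := .res) (p := .seq (.inc .tmp) (.inc .cnt))
    (fun n => ⟨E, M, V, [], (x - n) :: T, (x - n) :: C, U⟩) R 2 x fun n hn => by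
      have a1 := Run.inc (k := .tmp)
        (s := ⟨E, M, V, n :: R, (x - (n + 1)) :: T, (x - (n + 1)) :: C, U⟩) rfl
      have a2 := Run.inc (k := .cnt)
        (s := ⟨E, M, V, n :: R, (x - (n + 1) + 1) :: T, (x - (n + 1)) :: C, U⟩) rfl
      have := a1.seq a2
      simp only [show x - (n + 1) + 1 = x - n by omega] at this
      exact this
  simp only [Nat.sub_self, Nat.sub_zero] at h3
  have h4 := Run.move (j := .tmp) (k := .res) (s := ⟨E, M, V, R, x :: T, x :: C, U⟩)
    (by decide) rfl
  have h5 := Run.move (j := .cnt) (k := .res) (s := ⟨E, M, V, x :: R, T, x :: C, U⟩)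
    (by decide) rfl
  exact (h1.seq (h2.seq (h3.seq (h4.seq h5)))).mono (by omega)

/-! ### Random access to the contents of a stack -/

/-- The stacks that can be read at any position. -/
inductive Source
  | env | mem | vis

/-- A readable stack. -/
def Source.stack : Source → Stack
  | .env => .env
  | .mem => .mem
  | .vis => .vis

/-- Overwriting a readable stack and the stacks `res`, `tmp` and `cnt`. -/
def Source.put (k : Source) (s : State) (l R T C : List ℕ) : State :=
  match k with
  | .env => ⟨l, s.mem, s.vis, R, T, C, s.out⟩
  | .mem => ⟨s.env, l, s.vis, R, T, C, s.out⟩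
  | .vis => ⟨s.env, s.mem, l, R, T, C, s.out⟩

section put

variable (k : Source) (s : State) (l R T C x : List ℕ)

@[simp] theorem Source.get_put : (k.put s l R T C).get k.stack = l := by cases k <;> rfl

@[simp] theorem Source.get_res_put : (k.put s l R T C).get .res = R := by cases k <;> rfl

@[simp] theorem Source.get_tmp_put : (k.put s l R T C).get .tmp = T := by cases k <;> rfl

@[simp] theorem Source.get_cnt_put : (k.put s l R T C).get .cnt = C := by cases k <;> rfl

@[simp] theorem Source.set_put : (k.put s l R T C).set k.stack x = k.put s x R T C := by
  cases k <;> rfl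

@[simp] theorem Source.set_res_put : (k.put s l R T C).set .res x = k.put s l x T C := by
  cases k <;> rfl

@[simp] theorem Source.set_tmp_put : (k.put s l R T C).set .tmp x = k.put s l R x C := by
  cases k <;> rfl

@[simp] theorem Source.set_cnt_put : (k.put s l R T C).set .cnt x = k.put s l R T x := by
  cases k <;> rfl

theorem Source.stack_ne_tmp : k.stack ≠ .tmp := by cases k <;> decide

end put

/-- Copying the top number of a readable stack to the results. -/
def Prog.copyTop (k : Source) : Prog :=
  .seq (.zero .tmp) (.seq (.zero .res) (.seq (.loop k.stack (.seq (.inc .tmp) (.inc .res)))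
    (.move .tmp k.stack)))

theorem Run.copyTop (k : Source) (s : State) (l R T C : List ℕ) (x : ℕ) :
    Run (.copyTop k) (k.put s (x :: l) R T C) (k.put s (x :: l) (x :: R) T C) (x * 5 + 5) := by
  have h1 := Run.zero .tmp (k.put s (x :: l) R T C)
  have h2 := Run.zero .res (k.put s (x :: l) R (0 :: T) C)
  have h3 := Run.loop (k := k.stack) (p := .seq (.inc .tmp) (.inc .res))
    (fun n => k.put s [] ((x - n) :: R) ((x - n) :: T) C) l 2 x fun n hn => by
      have a1 := Run.inc (k := .tmp)
        (s := k.put s (n :: l) ((x - (n + 1)) :: R) ((x - (n + 1)) :: T) C)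
        (n := x - (n + 1)) (l := T) (by simp)
      have a2 := Run.inc (k := .res)
        (s := k.put s (n :: l) ((x - (n + 1)) :: R) ((x - (n + 1) + 1) :: T) C)
        (n := x - (n + 1)) (l := R) (by simp)
      simp only [Source.set_tmp_put, Source.set_res_put] at a1 a2
      have := a1.seq a2
      simp only [show x - (n + 1) + 1 = x - n by omega] at this
      simpa using this
  have h4 := Run.move (j := .tmp) (k := k.stack) (s := k.put s l (x :: R) (x :: T) C)
    (x := x) (l := T) (Source.stack_ne_tmp k).symm (by simp)
  simp only [Source.set_put, Source.set_tmp_put, Source.set_res_put, Source.get_put,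
    Source.get_tmp_put, Source.get_res_put, Nat.sub_self, Nat.sub_zero] at h1 h2 h3 h4
  exact (h1.seq (h2.seq (h3.seq h4))).mono (by omega)

theorem reverse_take_succ {l : List ℕ} {i : ℕ} (hi : i < l.length) :
    (l.take (i + 1)).reverse = l[i] :: (l.take i).reverse := by
  rw [List.take_succ_eq_append_getElem hi, List.reverse_append]
  rfl

/-- Replacing the top result `j` by the number at position `j` of a readable stack. -/
def Prog.lookup (k : Source) : Prog :=
  .seq (.zero .cnt) (.seq
    (.loop .res (.ifNonempty k.stack (.seq (.move k.stack .tmp) (.inc .cnt)) .skip))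
    (.seq (.ifNonempty k.stack (.copyTop k) (.zero .res)) (.loop .cnt (.move .tmp k.stack))))

/-- The entries before position `j` are moved to `tmp` and back again. The counter on `cnt` records
how many were really moved, `min j l.length`, so that reading beyond the end can be undone; the
result is then the default `0` of `getD`. -/
theorem Run.lookup (k : Source) (s : State) (l R T C : List ℕ) (j N : ℕ) (hl : ∀ x ∈ l, x ≤ N) :
    Run (.lookup k) (k.put s l (j :: R) T C) (k.put s l (l.getD j 0 :: R) T C)
      (j * (4 * N + 8) + 5 * N + 9) := by
  have h1 := Run.zero .cnt (k.put s l (j :: R) T C)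
  have h2 := Run.loop (k := .res)
    (p := .ifNonempty k.stack (.seq (.move k.stack .tmp) (.inc .cnt)) .skip)
    (fun n => k.put s (l.drop (j - n)) [] ((l.take (j - n)).reverse ++ T)
      (min (j - n) l.length :: C)) R (N * 2 + 4) j fun n hn => by
      simp only [Source.set_res_put]
      obtain ⟨i, rfl⟩ : ∃ i, j = i + n + 1 := ⟨j - (n + 1), by omega⟩
      rw [show i + n + 1 - (n + 1) = i by omega, show i + n + 1 - n = i + 1 by omega]
      by_cases hi : i < l.length
      · have hx : l.drop i = l[i] :: l.drop (i + 1) := List.drop_eq_getElem_cons hi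
        have a1 := Run.move (j := k.stack) (k := .tmp)
          (s := k.put s (l.drop i) (n :: R) ((l.take i).reverse ++ T) (min i l.length :: C))
          (x := l[i]) (l := l.drop (i + 1)) (Source.stack_ne_tmp k) (by rw [Source.get_put, hx])
        have a2 := Run.inc (k := .cnt)
          (s := k.put s (l.drop (i + 1)) (n :: R) (l[i] :: ((l.take i).reverse ++ T))
            (min i l.length :: C)) (n := min i l.length) (l := C) (by simp)
        simp only [Source.set_put, Source.set_tmp_put, Source.get_tmp_put,
          Source.set_cnt_put] at a1 a2
        have a3 := Run.ifNonempty_pos (k := k.stack) .skip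
          (by rw [Source.get_put, hx]; exact List.cons_ne_nil _ _) (a1.seq a2)
        have hb : l[i] ≤ N := hl _ (List.getElem_mem hi)
        rw [show min i l.length + 1 = min (i + 1) l.length by omega,
          ← List.cons_append, ← reverse_take_succ hi] at a3
        exact a3.mono (by omega)
      · have hd : l.drop i = [] := List.drop_eq_nil_of_le (by omega)
        have hd' : l.drop (i + 1) = [] := List.drop_eq_nil_of_le (by omega)
        rw [hd, hd', List.take_of_length_le (i := i) (by omega),
          List.take_of_length_le (i := i + 1) (by omega),
          show min i l.length = min (i + 1) l.length by omega]
        exact (Run.ifNonempty_neg _ (by simp) (Run.skip _)).mono (by omega)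
  have h3 : Run (.ifNonempty k.stack (.copyTop k) (.zero .res))
      (k.put s (l.drop j) R ((l.take j).reverse ++ T) (min j l.length :: C))
      (k.put s (l.drop j) (l.getD j 0 :: R) ((l.take j).reverse ++ T) (min j l.length :: C))
      (N * 5 + 6) := by
    by_cases hj : j < l.length
    · have hx : l.drop j = l[j] :: l.drop (j + 1) := List.drop_eq_getElem_cons hj
      have hb : l[j] ≤ N := hl _ (List.getElem_mem hj)
      rw [List.getD_eq_getElem _ _ hj, hx]
      exact (Run.ifNonempty_pos _ (by simpa using hj) (Run.copyTop k s _ _ _ _ _)).mono (by omega)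
    · rw [List.drop_eq_nil_of_le (by omega), List.getD_eq_default _ _ (by omega)]
      have := Run.zero .res (k.put s [] R ((l.take j).reverse ++ T) (min j l.length :: C))
      simp only [Source.set_res_put, Source.get_res_put] at this
      exact (Run.ifNonempty_neg _ (by simp) this).mono (by omega)
  have h4 := Run.loop (k := .cnt) (p := .move .tmp k.stack)
    (fun n => k.put s (l.drop n) (l.getD j 0 :: R) ((l.take n).reverse ++ T) []) C
    (N * 2 + 2) (min j l.length) fun n hn => by
      have hi : n < l.length := by omega
      have hb : l[n] ≤ N := hl _ (List.getElem_mem hi)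
      simp only [Source.set_cnt_put]
      have := Run.move (j := .tmp) (k := k.stack)
        (s := k.put s (l.drop (n + 1)) (l.getD j 0 :: R) ((l.take (n + 1)).reverse ++ T) (n :: C))
        (x := l[n]) (l := (l.take n).reverse ++ T) (Source.stack_ne_tmp k).symm
        (by rw [Source.get_tmp_put, reverse_take_succ hi, List.cons_append])
      simp only [Source.set_put, Source.set_tmp_put, Source.get_put] at this
      rw [← List.drop_eq_getElem_cons hi] at this
      exact this.mono (by omega)
  simp only [Source.set_cnt_put, Source.get_cnt_put, Source.set_res_put, Nat.sub_self,
    Nat.sub_zero, List.take_zero, List.drop_zero, List.reverse_nil, List.nil_append,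
    Nat.zero_min] at h1 h2 h4
  have e1 : l.drop (min j l.length) = l.drop j := by
    rcases le_total j l.length with h | h
    · rw [min_eq_left h]
    · rw [min_eq_right h, List.drop_length, List.drop_eq_nil_of_le h]
  have e2 : l.take (min j l.length) = l.take j := by
    rcases le_total j l.length with h | h
    · rw [min_eq_left h]
    · rw [min_eq_right h, List.take_length, List.take_of_length_le h]
  rw [e1, e2] at h4
  have hm : min j l.length * (N * 2 + 2 + 1) ≤ j * (N * 2 + 2 + 1) :=
    Nat.mul_le_mul_right _ (min_le_left _ _)
  refine (h1.seq (h2.seq (h3.seq h4))).mono ?_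
  nlinarith

end StackProgram

namespace StackProgram

/-! ### Arithmetical expressions -/

/-- Expressions for numbers. Variables are numbered from the innermost binder, and `mem` and `vis`
read the two tables. -/
inductive Expr
  | lit (n : ℕ) : Expr
  | var (i : ℕ) : Expr
  | add (a b : Expr) : Expr
  | sub (a b : Expr) : Expr
  | sum (n b : Expr) : Expr
  | iter (n c b : Expr) : Expr
  | mem (a : Expr) : Expr
  | vis (a : Expr) : Expr

/-- The value of an expression. In `iter n c b` the function `b` is iterated `n` times, starting
with `0`, all values being capped by `c`. -/
def Expr.eval (M V : List ℕ) : Expr → List ℕ → ℕ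
  | .lit n, _ => n
  | .var i, E => E.getD i 0
  | .add a b, E => a.eval M V E + b.eval M V E
  | .sub a b, E => a.eval M V E - b.eval M V E
  | .sum n b, E => ∑ i ∈ Finset.range (n.eval M V E), b.eval M V (i :: E)
  | .iter n c b, E => (fun x => min (b.eval M V (x :: E)) (c.eval M V E))^[n.eval M V E] 0
  | .mem a, E => M.getD (a.eval M V E) 0
  | .vis a, E => V.getD (a.eval M V E) 0

/-- Pushing a constant onto the results. -/
def Prog.lit : ℕ → Prog
  | 0 => .zero .res
  | n + 1 => .seq (Prog.lit n) (.inc .res)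

theorem Run.lit (E M V R T C U : List ℕ) (n : ℕ) :
    Run (.lit n) ⟨E, M, V, R, T, C, U⟩ ⟨E, M, V, n :: R, T, C, U⟩ (n + 1) := by
  induction n with
  | zero => exact Run.zero .res _
  | succ n ih => exact ih.seq (Run.inc (k := .res) (s := ⟨E, M, V, n :: R, T, C, U⟩) rfl)

/-- The program that pushes the value of an expression onto the results. -/
def Expr.compile : Expr → Prog
  | .lit n => .lit n
  | .var i => .seq (.lit i) (.lookup .env)
  | .add a b => .seq a.compile (.seq b.compile .addTop)
  | .sub a b => .seq a.compile (.seq b.compile .subTop)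
  | .sum n b =>
    .seq n.compile (.seq (.move .res .cnt) (.seq (.zero .res) (.seq (.zero .env)
      (.seq (.loop .cnt (.seq b.compile (.seq .addTop (.inc .env)))) (.drop .env)))))
  | .iter n c b =>
    .seq n.compile (.seq (.move .res .cnt) (.seq (.zero .res)
      (.loop .cnt (.seq (.move .res .env) (.seq b.compile (.seq (.drop .env)
        (.seq .dup (.seq c.compile (.seq .subTop .subTop)))))))))
  | .mem a => .seq a.compile (.lookup .mem)
  | .vis a => .seq a.compile (.lookup .vis)

/-- All numbers of a list are at most `N`. -/
def BoundedBy (N : ℕ) (l : List ℕ) : Prop := ∀ x ∈ l, x ≤ N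

theorem BoundedBy.mono {N N' : ℕ} {l : List ℕ} (h : BoundedBy N l) (hN : N ≤ N') :
    BoundedBy N' l := fun x hx => (h x hx).trans hN

theorem BoundedBy.cons {N x : ℕ} {l : List ℕ} (h : BoundedBy N l) (hx : x ≤ N) :
    BoundedBy N (x :: l) := by
  intro y hy
  rcases List.mem_cons.1 hy with rfl | hy
  · exact hx
  · exact h y hy

theorem BoundedBy.getD_le {N : ℕ} {l : List ℕ} (h : BoundedBy N l) (j : ℕ) : l.getD j 0 ≤ N := by
  by_cases hj : j < l.length
  · rw [List.getD_eq_getElem _ _ hj]; exact h _ (List.getElem_mem hj)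
  · rw [List.getD_eq_default _ _ (by omega)]; exact Nat.zero_le _

/-- The values of an expression are bounded by a polynomial in a bound of all arguments. -/
theorem Expr.eval_le (e : Expr) : ∃ P : Polynomial ℕ, ∀ (N : ℕ) (E M V : List ℕ),
    BoundedBy N E → BoundedBy N M → BoundedBy N V → e.eval M V E ≤ P.eval N := by
  induction e with
  | lit n => exact ⟨.C n, fun N E M V _ _ _ => by simp [Expr.eval]⟩
  | var i => exact ⟨.X, fun N E M V hE _ _ => by simpa [Expr.eval] using hE.getD_le i⟩
  | add a b iha ihb =>
    obtain ⟨P, hP⟩ := iha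
    obtain ⟨Q, hQ⟩ := ihb
    refine ⟨P + Q, fun N E M V hE hM hV => ?_⟩
    rw [Polynomial.eval_add]
    exact add_le_add (hP N E M V hE hM hV) (hQ N E M V hE hM hV)
  | sub a b iha ihb =>
    obtain ⟨P, hP⟩ := iha
    exact ⟨P, fun N E M V hE hM hV => (Nat.sub_le _ _).trans (hP N E M V hE hM hV)⟩
  | sum n b ihn ihb =>
    obtain ⟨P, hP⟩ := ihn
    obtain ⟨Q, hQ⟩ := ihb
    -- The summation index is below `P.eval N`, so `N + P.eval N` bounds the extended environment.
    refine ⟨P * Q.comp (.X + P), fun N E M V hE hM hV => ?_⟩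
    have hn := hP N E M V hE hM hV
    have hN : N ≤ N + P.eval N := Nat.le_add_right _ _
    rw [Polynomial.eval_mul, Polynomial.eval_comp, Polynomial.eval_add, Polynomial.eval_X]
    refine le_trans (Finset.sum_le_card_nsmul _ _ (Q.eval (N + P.eval N)) fun i hi => ?_) ?_
    · have hi := Finset.mem_range.1 hi
      exact hQ _ _ _ _ ((hE.mono hN).cons (by omega)) (hM.mono hN) (hV.mono hN)
    · rw [Finset.card_range, smul_eq_mul]
      exact Nat.mul_le_mul_right _ hn
  | iter n c b ihn ihc ihb =>
    obtain ⟨P, hP⟩ := ihc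
    -- The cap alone bounds all iterates. Without it, iterated doubling would give exponential
    -- values.
    refine ⟨P, fun N E M V hE hM hV => ?_⟩
    rw [Expr.eval]
    cases n.eval M V E with
    | zero => exact Nat.zero_le _
    | succ k =>
      rw [Function.iterate_succ_apply']
      exact (min_le_right _ _).trans (hP N E M V hE hM hV)
  | mem a _ => exact ⟨.X, fun N E M V _ hM _ => by simpa [Expr.eval] using hM.getD_le _⟩
  | vis a _ => exact ⟨.X, fun N E M V _ _ hV => by simpa [Expr.eval] using hV.getD_le _⟩

/-- Expressions are evaluated in polynomial time. -/
theorem Expr.run_compile (e : Expr) : ∃ P : Polynomial ℕ, ∀ (N : ℕ) (E M V R T C U : List ℕ),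
    BoundedBy N E → BoundedBy N M → BoundedBy N V →
    Run e.compile ⟨E, M, V, R, T, C, U⟩ ⟨E, M, V, e.eval M V E :: R, T, C, U⟩ (P.eval N) := by
  induction e with
  | lit n =>
    exact ⟨.C (n + 1), fun N E M V R T C U _ _ _ => (Run.lit E M V R T C U n).mono (by simp)⟩
  | var i =>
    refine ⟨.C (i + 1) + (.C i * (4 * .X + 8) + 5 * .X + 9), fun N E M V R T C U hE _ _ => ?_⟩
    have h := (Run.lit E M V R T C U i).seq
      (Run.lookup .env ⟨E, M, V, [], T, C, U⟩ E R T C i N hE)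
    exact h.mono (by simp)
  | add a b iha ihb =>
    obtain ⟨P, hP⟩ := iha
    obtain ⟨Q, hQ⟩ := ihb
    obtain ⟨B, hB⟩ := b.eval_le
    refine ⟨P + (Q + (B * 4 + 3)), fun N E M V R T C U hE hM hV => ?_⟩
    have h := (hP N E M V R T C U hE hM hV).seq ((hQ N E M V _ T C U hE hM hV).seq
      (Run.addTop E M V R T C U (a.eval M V E) (b.eval M V E)))
    have hb := hB N E M V hE hM hV
    exact h.mono (by simp; omega)
  | sub a b iha ihb =>
    obtain ⟨P, hP⟩ := iha
    obtain ⟨Q, hQ⟩ := ihb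
    obtain ⟨A, hA⟩ := a.eval_le
    obtain ⟨B, hB⟩ := b.eval_le
    refine ⟨P + (Q + (B * 2 + 2 + (B * (A * 4 + 7) + 1))), fun N E M V R T C U hE hM hV => ?_⟩
    have h := (hP N E M V R T C U hE hM hV).seq ((hQ N E M V _ T C U hE hM hV).seq
      (Run.subTop E M V R T C U (a.eval M V E) (b.eval M V E)))
    have ha := hA N E M V hE hM hV
    have hb := hB N E M V hE hM hV
    refine h.mono ?_
    simp only [Polynomial.eval_add, Polynomial.eval_mul, Polynomial.eval_ofNat,
      Polynomial.eval_one]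
    gcongr
  | sum n b ihn ihb =>
    obtain ⟨P, hP⟩ := ihn
    obtain ⟨Q, hQ⟩ := ihb
    obtain ⟨A, hA⟩ := n.eval_le
    obtain ⟨B, hB⟩ := b.eval_le
    refine ⟨P + (A * 2 + 2 + (1 + (1 + (A * (Q.comp (.X + A) +
      (B.comp (.X + A) * 4 + 3 + 1) + 1) + 1 + (A * 2 + 1))))), fun N E M V R T C U hE hM hV => ?_⟩
    have hn := hA N E M V hE hM hV
    have hN : N ≤ N + A.eval N := Nat.le_add_right _ _
    have h1 := hP N E M V R T C U hE hM hV
    set v := n.eval M V E with hv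
    have h2 := Run.move (j := .res) (k := .cnt) (s := ⟨E, M, V, v :: R, T, C, U⟩) (by decide) rfl
    have h3 := Run.zero .res ⟨E, M, V, R, T, v :: C, U⟩
    have h4 := Run.zero .env ⟨E, M, V, 0 :: R, T, v :: C, U⟩
    have h5 := Run.loop (k := .cnt) (p := .seq b.compile (.seq .addTop (.inc .env)))
      (fun m => ⟨(v - m) :: E, M, V,
        (∑ i ∈ Finset.range (v - m), b.eval M V (i :: E)) :: R, T, [], U⟩)
      C (Q.eval (N + A.eval N) + (B.eval (N + A.eval N) * 4 + 3 + 1)) v fun m hm => by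
        obtain ⟨i, hi⟩ : ∃ i, v = i + m + 1 := ⟨v - (m + 1), by omega⟩
        rw [show v - (m + 1) = i by omega, show v - m = i + 1 by omega]
        have hE' : BoundedBy (N + A.eval N) (i :: E) := (hE.mono hN).cons (by omega)
        have a1 := hQ _ (i :: E) M V ((∑ j ∈ Finset.range i, b.eval M V (j :: E)) :: R) T (m :: C) U
          hE' (hM.mono hN) (hV.mono hN)
        have a2 := Run.addTop (i :: E) M V R T (m :: C) U (∑ j ∈ Finset.range i, b.eval M V (j :: E))
          (b.eval M V (i :: E))
        rw [← Finset.sum_range_succ (fun j => b.eval M V (j :: E))] at a2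
        have hb := hB _ _ _ _ hE' (hM.mono hN) (hV.mono hN)
        exact (a1.seq (a2.seq (Run.inc (k := .env) (s := ⟨i :: E, M, V, _, T, m :: C, U⟩) rfl))).mono
          (by omega)
    simp only [Nat.sub_self, Nat.sub_zero, Finset.range_zero, Finset.sum_empty] at h5
    have h6 := Run.drop (k := .env)
      (s := ⟨v :: E, M, V, (∑ i ∈ Finset.range v, b.eval M V (i :: E)) :: R, T, C, U⟩) rfl
    refine (h1.seq (h2.seq (h3.seq (h4.seq (h5.seq h6))))).mono ?_
    simp only [Polynomial.eval_add, Polynomial.eval_mul, Polynomial.eval_ofNat,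
      Polynomial.eval_one, Polynomial.eval_comp, Polynomial.eval_X]
    gcongr
  | iter n c b ihn ihc ihb =>
    obtain ⟨P, hP⟩ := ihn
    obtain ⟨Q, hQ⟩ := ihc
    obtain ⟨S, hS⟩ := ihb
    obtain ⟨A, hA⟩ := n.eval_le
    obtain ⟨B, hB⟩ := c.eval_le
    obtain ⟨D, hD⟩ := b.eval_le
    refine ⟨P + (A * 2 + 2 + (1 + (A * (B * 2 + 2 + (S.comp (.X + B) + (B * 2 + 1 +
      (D.comp (.X + B) * 7 + 7 + (Q + (B * 2 + 2 + (B * (D.comp (.X + B) * 4 + 7) + 1) +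
      (D.comp (.X + B) * 2 + 2 + (D.comp (.X + B) * (D.comp (.X + B) * 4 + 7) + 1))))))) + 1) + 1))),
      fun N E M V R T C U hE hM hV => ?_⟩
    have hn := hA N E M V hE hM hV
    have hc := hB N E M V hE hM hV
    have hN : N ≤ N + B.eval N := Nat.le_add_right _ _
    have h1 := hP N E M V R T C U hE hM hV
    set v := n.eval M V E with hv
    set f : ℕ → ℕ := fun x => min (b.eval M V (x :: E)) (c.eval M V E) with hf
    have hbd : ∀ i, f^[i] 0 ≤ B.eval N := by
      intro i
      cases i with
      | zero => exact Nat.zero_le _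
      | succ i =>
        rw [Function.iterate_succ_apply']
        exact (min_le_right _ _).trans hc
    have h2 := Run.move (j := .res) (k := .cnt) (s := ⟨E, M, V, v :: R, T, C, U⟩) (by decide) rfl
    have h3 := Run.zero .res ⟨E, M, V, R, T, v :: C, U⟩
    have h5 := Run.loop (k := .cnt) (p := .seq (.move .res .env) (.seq b.compile (.seq (.drop .env)
        (.seq .dup (.seq c.compile (.seq .subTop .subTop))))))
      (fun m => ⟨E, M, V, f^[v - m] 0 :: R, T, [], U⟩)
      C (B.eval N * 2 + 2 + (S.eval (N + B.eval N) + (B.eval N * 2 + 1 +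
      (D.eval (N + B.eval N) * 7 + 7 + (Q.eval N + (B.eval N * 2 + 2 +
      (B.eval N * (D.eval (N + B.eval N) * 4 + 7) + 1) +
      (D.eval (N + B.eval N) * 2 + 2 +
        (D.eval (N + B.eval N) * (D.eval (N + B.eval N) * 4 + 7) + 1)))))))) v
      fun m hm => by
        obtain ⟨i, hi⟩ : ∃ i, v = i + m + 1 := ⟨v - (m + 1), by omega⟩
        rw [show v - (m + 1) = i by omega, show v - m = i + 1 by omega,
          Function.iterate_succ_apply']
        have hx := hbd i
        set x := f^[i] 0
        have hE' : BoundedBy (N + B.eval N) (x :: E) := (hE.mono hN).cons (by omega)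
        have a1 := Run.move (j := .res) (k := .env) (s := ⟨E, M, V, x :: R, T, m :: C, U⟩)
          (by decide) rfl
        have a2 := hS _ (x :: E) M V R T (m :: C) U hE' (hM.mono hN) (hV.mono hN)
        have hb := hD _ _ _ _ hE' (hM.mono hN) (hV.mono hN)
        -- The minimum of `y` and `c` is `y - (y - c)`, which is why the program duplicates `y` and
        -- subtracts twice.
        have hfx : f x = b.eval M V (x :: E) - (b.eval M V (x :: E) - c.eval M V E) := by
          change min _ _ = _
          omega
        set y := b.eval M V (x :: E)
        have a3 := Run.drop (k := .env) (s := ⟨x :: E, M, V, y :: R, T, m :: C, U⟩) rfl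
        have a4 := Run.dup E M V R T (m :: C) U y
        have a5 := hQ N E M V (y :: y :: R) T (m :: C) U hE hM hV
        have a6 := Run.subTop E M V (y :: R) T (m :: C) U y (c.eval M V E)
        have a7 := Run.subTop E M V R T (m :: C) U y (y - c.eval M V E)
        rw [← hfx] at a7
        have hyc : y - c.eval M V E ≤ D.eval (N + B.eval N) := (Nat.sub_le _ _).trans hb
        refine (a1.seq (a2.seq (a3.seq (a4.seq (a5.seq (a6.seq a7)))))).mono ?_
        gcongr
    simp only [Nat.sub_self, Nat.sub_zero, Function.iterate_zero, id] at h5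
    refine (h1.seq (h2.seq (h3.seq h5))).mono ?_
    simp only [Polynomial.eval_add, Polynomial.eval_mul, Polynomial.eval_ofNat,
      Polynomial.eval_one, Polynomial.eval_comp, Polynomial.eval_X]
    gcongr
  | mem a iha =>
    obtain ⟨P, hP⟩ := iha
    obtain ⟨A, hA⟩ := a.eval_le
    refine ⟨P + (A * (4 * .X + 8) + 5 * .X + 9), fun N E M V R T C U hE hM hV => ?_⟩
    have h := (hP N E M V R T C U hE hM hV).seq
      (Run.lookup .mem ⟨E, M, V, [], T, C, U⟩ M R T C (a.eval M V E) N hM)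
    have ha := hA N E M V hE hM hV
    refine h.mono ?_
    simp only [Polynomial.eval_add, Polynomial.eval_mul, Polynomial.eval_ofNat, Polynomial.eval_X]
    gcongr
  | vis a iha =>
    obtain ⟨P, hP⟩ := iha
    obtain ⟨A, hA⟩ := a.eval_le
    refine ⟨P + (A * (4 * .X + 8) + 5 * .X + 9), fun N E M V R T C U hE hM hV => ?_⟩
    have h := (hP N E M V R T C U hE hM hV).seq
      (Run.lookup .vis ⟨E, M, V, [], T, C, U⟩ V R T C (a.eval M V E) N hV)
    have ha := hA N E M V hE hM hV
    refine h.mono ?_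
    simp only [Polynomial.eval_add, Polynomial.eval_mul, Polynomial.eval_ofNat, Polynomial.eval_X]
    gcongr

end StackProgram

namespace StackProgram

/-! ### Iterating a definable operator on tables -/

/-- Emptying a stack. -/
def Prog.clear (k : Stack) : Prog := .whileNonempty k (.drop k)

theorem Run.clear {k : Stack} {N : ℕ} {l : List ℕ} (hl : BoundedBy N l) :
    ∀ {s : State}, s.get k = l → Run (.clear k) s (s.set k []) (l.length * (2 * N + 2) + 1) := by
  induction l with
  | nil =>
    intro s h
    have := Run.while_nil (.drop k) h
    rw [← h, State.set_get]
    exact this.mono (by omega)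
  | cons x l ih =>
    intro s h
    have h1 := ih (fun y hy => hl y (List.mem_cons_of_mem _ hy)) (s := s.set k l) (by simp)
    rw [State.set_set] at h1
    have hx : x ≤ N := hl x List.mem_cons_self
    refine (Run.while_cons (by simp [h]) (Run.drop h) h1).mono ?_
    rw [List.length_cons, Nat.add_mul l.length, Nat.one_mul]
    omega

/-- Moving all numbers of a stack to another stack, which reverses their order. -/
def Prog.pour (j k : Stack) : Prog := .whileNonempty j (.move j k)

theorem Run.pour {j k : Stack} (hjk : j ≠ k) {N : ℕ} {l : List ℕ} (hl : BoundedBy N l) :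
    ∀ {s : State}, s.get j = l → Run (.pour j k) s ((s.set j []).set k (l.reverse ++ s.get k))
      (l.length * (2 * N + 3) + 1) := by
  induction l with
  | nil =>
    intro s h
    have := Run.while_nil (.move j k) h
    rw [← h, State.set_get]
    simp only [h, List.reverse_nil, List.nil_append, State.set_get]
    exact this.mono (by omega)
  | cons x l ih =>
    intro s h
    have h1 := ih (fun y hy => hl y (List.mem_cons_of_mem _ hy))
      (s := (s.set j l).set k (x :: s.get k)) (by rw [State.get_set_of_ne _ hjk]; simp)
    rw [State.set_comm _ hjk, State.set_set, State.set_set, State.get_set_self] at h1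
    have hx : x ≤ N := hl x List.mem_cons_self
    have h2 := Run.while_cons (by simp [h]) (Run.move hjk h) h1
    rw [List.reverse_cons, List.append_assoc]
    refine h2.mono ?_
    rw [List.length_cons, Nat.add_mul l.length, Nat.one_mul]
    omega

/-- Moving the input to an auxiliary stack, counting its bits. -/
def Prog.measure : Prog :=
  .whileNonempty .mem (.seq (.zero .tmp) (.seq (.loop .mem (.seq (.inc .tmp) (.inc .env)))
    (.inc .env)))

theorem length_unary_cons (x : ℕ) (l : List ℕ) :
    (unary (x :: l)).length = x + 1 + (unary l).length := by
  simp [unary]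
  omega

theorem length_le_length_unary (l : List ℕ) : l.length ≤ (unary l).length := by
  induction l with
  | nil => exact le_rfl
  | cons x l ih => rw [length_unary_cons, List.length_cons]; omega

theorem lt_length_unary {x : ℕ} {l : List ℕ} (h : x ∈ l) : x < (unary l).length := by
  induction l with
  | nil => simp at h
  | cons y l ih =>
    rw [length_unary_cons]
    rcases List.mem_cons.1 h with rfl | h
    · omega
    · have := ih h; omega

/-- The length of the encoding serves later as the bound on all numbers of the input. A number `x`
occupies `x + 1` bits, hence the increment after the inner loop. -/
theorem Run.measure (l : List ℕ) : ∀ (n : ℕ) (T : List ℕ),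
    Run .measure ⟨[n], l, [], [], T, [], []⟩
      ⟨[n + (unary l).length], [], [], [], l.reverse ++ T, [], []⟩
      ((unary l).length * 5 + 1) := by
  induction l with
  | nil => exact fun n T => Run.while_nil _ rfl
  | cons x l ih =>
    intro n T
    have h1 := Run.zero .tmp ⟨[n], x :: l, [], [], T, [], []⟩
    have h2 := Run.loop (k := .mem) (p := .seq (.inc .tmp) (.inc .env))
      (fun m => ⟨[n + (x - m)], [], [], [], (x - m) :: T, [], []⟩) l 2 x fun m hm => by
        have a1 := Run.inc (k := .tmp)
          (s := ⟨[n + (x - (m + 1))], m :: l, [], [], (x - (m + 1)) :: T, [], []⟩) rfl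
        have a2 := Run.inc (k := .env)
          (s := ⟨[n + (x - (m + 1))], m :: l, [], [], (x - (m + 1) + 1) :: T, [], []⟩) rfl
        have := a1.seq a2
        simp only [show n + (x - (m + 1)) + 1 = n + (x - m) by omega,
          show x - (m + 1) + 1 = x - m by omega] at this
        exact this
    simp only [Nat.sub_self, Nat.sub_zero, Nat.add_zero] at h2
    have h3 := Run.inc (k := .env) (s := ⟨[n + x], l, [], [], x :: T, [], []⟩) rfl
    have h4 := ih (n + x + 1) (x :: T)
    have := Run.while_cons (k := .mem) (s := ⟨[n], x :: l, [], [], T, [], []⟩)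
      (List.cons_ne_nil _ _) (h1.seq (h2.seq h3)) h4
    rw [length_unary_cons, List.reverse_cons, List.append_assoc,
      show n + (x + 1 + (unary l).length) = n + x + 1 + (unary l).length by omega]
    exact this.mono (by omega)

/-- Replacing the table `vis` by the table of the values of `step` at the numbers below the value
of `size`. -/
def Prog.round (size step : Expr) : Prog :=
  .seq size.compile (.seq (.move .res .cnt) (.seq (.zero .env)
    (.seq (.loop .cnt (.seq step.compile (.seq (.move .res .out) (.inc .env))))
      (.seq (.drop .env) (.seq (.clear .vis) (.pour .out .vis))))))

/-- Iterating `round` and evaluating `final` thereafter, the only variable being the length of the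
input. -/
def Prog.solve (size step final : Expr) : Prog :=
  .seq (.zero .env) (.seq .measure (.seq (.pour .tmp .mem) (.seq size.compile
    (.seq (.move .res .cnt) (.seq (.loop .cnt (.round size step)) (.seq final.compile
      (.seq (.clear .vis) (.seq (.clear .mem) (.clear .env)))))))))

/-- The table of the values of `step` at the numbers below `m`. -/
def Expr.table (step : Expr) (m L : ℕ) (M V : List ℕ) : List ℕ :=
  (List.range m).map fun x => step.eval M V [x, L]

/-- The new table grows on `out`, in reverse order, while the old one remains readable; `pour`
restores the order. As `step` yields only bits and the length is at most `L ^ d`, one polynomial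
bounds every round, whatever table it starts from. -/
theorem Run.round {size step : Expr} {d : ℕ} (hsize : ∀ M V L, size.eval M V [L] = L ^ d)
    (hstep : ∀ M V E, step.eval M V E ≤ 1) :
    ∃ P : Polynomial ℕ, ∀ (L : ℕ) (M V C : List ℕ), BoundedBy L M → BoundedBy 1 V →
      V.length ≤ L ^ d →
      Run (.round size step) ⟨[L], M, V, [], [], C, []⟩
        ⟨[L], M, step.table (L ^ d) L M V, [], [], C, []⟩ (P.eval L) := by
  obtain ⟨P, hP⟩ := size.run_compile
  obtain ⟨Q, hQ⟩ := step.run_compile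
  refine ⟨P.comp (.X + 1) + (.X ^ d * 2 + 2 + (1 + (.X ^ d * (Q.comp (.X + 1 + .X ^ d) +
    (4 + 1) + 1) + 1 + (.X ^ d * 2 + 1 + ((.X ^ d * 4 + 1) + (.X ^ d * 5 + 1)))))),
    fun L M V C hM hV hlen => ?_⟩
  set m := L ^ d with hm
  set f : ℕ → ℕ := fun x => step.eval M V [x, L] with hf
  have hE : BoundedBy (L + 1) [L] := by intro x hx; simp at hx; omega
  have h1 := hP (L + 1) [L] M V [] [] C [] hE (hM.mono (by omega)) (hV.mono (by omega))
  rw [hsize] at h1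
  have h2 := Run.move (j := .res) (k := .cnt) (s := ⟨[L], M, V, [m], [], C, []⟩) (by decide) rfl
  have h3 := Run.zero .env ⟨[L], M, V, [], [], m :: C, []⟩
  have h4 := Run.loop (k := .cnt) (p := .seq step.compile (.seq (.move .res .out) (.inc .env)))
    (fun n => ⟨[m - n, L], M, V, [], [], [], ((List.range (m - n)).map f).reverse⟩) C
    (Q.eval (L + 1 + m) + (4 + 1)) m fun n hn => by
      obtain ⟨i, hi⟩ : ∃ i, m = i + n + 1 := ⟨m - (n + 1), by omega⟩
      rw [show m - (n + 1) = i by omega, show m - n = i + 1 by omega]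
      have a1 := hQ (L + 1 + m) [i, L] M V [] [] (n :: C) ((List.range i).map f).reverse
        ((hE.mono (by omega)).cons (by omega)) (hM.mono (by omega)) (hV.mono (by omega))
      have a2 := Run.move (j := .res) (k := .out)
        (s := ⟨[i, L], M, V, [f i], [], n :: C, ((List.range i).map f).reverse⟩) (by decide) rfl
      have a3 := Run.inc (k := .env)
        (s := ⟨[i, L], M, V, [], [], n :: C, f i :: ((List.range i).map f).reverse⟩) rfl
      have hfi : f i ≤ 1 := hstep _ _ _
      have := (a1.seq (a2.seq a3)).mono (t' := Q.eval (L + 1 + m) + (4 + 1)) (by omega)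
      rw [List.range_succ, List.map_append, List.reverse_append]
      exact this
  simp only [Nat.sub_self, Nat.sub_zero, List.range_zero, List.map_nil, List.reverse_nil] at h4
  have h5 := Run.drop (k := .env)
    (s := ⟨[m, L], M, V, [], [], C, ((List.range m).map f).reverse⟩) rfl
  have h6 := Run.clear (k := .vis) hV
    (s := ⟨[L], M, V, [], [], C, ((List.range m).map f).reverse⟩) rfl
  have hb : BoundedBy 1 ((List.range m).map f).reverse := by
    intro x hx
    rw [List.mem_reverse, List.mem_map] at hx
    obtain ⟨y, _, rfl⟩ := hx
    exact hstep _ _ _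
  have h7 := Run.pour (j := .out) (k := .vis) (by decide) hb
    (s := ⟨[L], M, [], [], [], C, ((List.range m).map f).reverse⟩) rfl
  rw [List.reverse_reverse, List.length_reverse, List.length_map, List.length_range] at h7
  have h7' : Run (.pour .out .vis) ⟨[L], M, [], [], [], C, ((List.range m).map f).reverse⟩
      ⟨[L], M, step.table m L M V, [], [], C, []⟩ (m * 5 + 1) := by
    have e : (List.range m).map f ++ [] = step.table m L M V := List.append_nil _
    rw [← e]
    exact h7
  refine (h1.seq (h2.seq (h3.seq (h4.seq (h5.seq (h6.seq h7')))))).mono ?_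
  simp only [Polynomial.eval_add, Polynomial.eval_mul, Polynomial.eval_ofNat,
    Polynomial.eval_one, Polynomial.eval_comp, Polynomial.eval_X, Polynomial.eval_pow, ← hm]
  gcongr
  omega

theorem Expr.boundedBy_iterate_table {step : Expr} (hstep : ∀ M V E, step.eval M V E ≤ 1)
    (m L : ℕ) (M : List ℕ) (k : ℕ) :
    BoundedBy 1 ((step.table m L M)^[k] []) ∧ ((step.table m L M)^[k] []).length ≤ m := by
  cases k with
  | zero => exact ⟨fun x hx => by simp at hx, by simp⟩
  | succ k =>
    rw [Function.iterate_succ_apply']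
    refine ⟨fun x hx => ?_, by simp [Expr.table]⟩
    obtain ⟨y, _, rfl⟩ := List.mem_map.1 hx
    exact hstep _ _ _

/-- There are as many rounds as table entries, which is enough for a monotone operator on sets of
entries to stabilize. -/
theorem Run.solve {size step final : Expr} {d : ℕ}
    (hsize : ∀ M V L, size.eval M V [L] = L ^ d) (hstep : ∀ M V E, step.eval M V E ≤ 1) :
    ∃ P : Polynomial ℕ, ∀ (M : List ℕ) (L : ℕ), L = (unary M).length →
      Run (.solve size step final) { mem := M }
        { res := [final.eval M ((step.table (L ^ d) L M)^[L ^ d] []) [L]] } (P.eval L) := by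
  obtain ⟨P, hP⟩ := size.run_compile
  obtain ⟨Q, hQ⟩ := Run.round hsize hstep
  obtain ⟨S, hS⟩ := final.run_compile
  refine ⟨1 + (.X * 5 + 1 + (.X * (2 * .X + 3) + 1 + (P.comp (.X + 1) + (.X ^ d * 2 + 2 +
    (.X ^ d * (Q + 1) + 1 + (S.comp (.X + 1) + (.X ^ d * 4 + 1 + (.X * (2 * .X + 2) + 1 +
      (2 * .X + 2 + 1))))))))), fun M L hL => ?_⟩
  set m := L ^ d with hm
  set g := step.table m L M with hg
  have hM : BoundedBy L M := fun x hx => by have := lt_length_unary hx; omega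
  have hlen : M.length ≤ L := by rw [hL]; exact length_le_length_unary M
  have hE : BoundedBy (L + 1) [L] := by intro x hx; simp at hx; omega
  have h1 := Run.zero .env { mem := M }
  have h2 := Run.measure M 0 []
  rw [← hL, Nat.zero_add, List.append_nil] at h2
  have h3 := Run.pour (j := .tmp) (k := .mem) (N := L) (l := M.reverse) (by decide)
    (fun x hx => hM x (List.mem_reverse.1 hx))
    (s := ⟨[L], [], [], [], M.reverse, [], []⟩) rfl
  have h3' : Run (.pour .tmp .mem) ⟨[L], [], [], [], M.reverse, [], []⟩
      ⟨[L], M, [], [], [], [], []⟩ (L * (2 * L + 3) + 1) := by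
    have e : M.reverse.reverse ++ [] = M := by simp
    have := h3.mono (t' := L * (2 * L + 3) + 1) (by rw [List.length_reverse]; gcongr)
    rw [← e]
    rw [List.reverse_append, List.reverse_reverse]
    exact this
  have h4 := hP (L + 1) [L] M [] [] [] [] [] hE (hM.mono (by omega)) (fun x hx => by simp at hx)
  rw [hsize] at h4
  have h5 := Run.move (j := .res) (k := .cnt) (s := ⟨[L], M, [], [m], [], [], []⟩) (by decide) rfl
  have h6 := Run.loop (k := .cnt) (p := .round size step)
    (fun n => ⟨[L], M, g^[m - n] [], [], [], [], []⟩) [] (Q.eval L) m fun n hn => by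
      obtain ⟨hb, hl⟩ := Expr.boundedBy_iterate_table hstep m L M (m - (n + 1))
      have := hQ L M (g^[m - (n + 1)] []) [n] hM hb hl
      rw [show m - n = m - (n + 1) + 1 by omega, Function.iterate_succ_apply']
      exact this
  simp only [Nat.sub_self, Nat.sub_zero, Function.iterate_zero, id] at h6
  obtain ⟨hb, hl⟩ := Expr.boundedBy_iterate_table hstep m L M m
  rw [← hg] at hb hl
  set V := g^[m] [] with hV
  have h7 := hS (L + 1) [L] M V [] [] [] [] hE (hM.mono (by omega)) (hb.mono (by omega))
  set b := final.eval M V [L]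
  have h8 := Run.clear (k := .vis) hb (s := ⟨[L], M, V, [b], [], [], []⟩) rfl
  have h9 := Run.clear (k := .mem) hM (s := ⟨[L], M, [], [b], [], [], []⟩) rfl
  have h10 := Run.clear (k := .env) (l := [L]) (N := L) (by intro x hx; simp at hx; omega)
    (s := ⟨[L], [], [], [b], [], [], []⟩) rfl
  refine (h1.seq (h2.seq (h3'.seq (h4.seq (h5.seq (h6.seq (h7.seq (h8.seq
    (h9.seq h10))))))))).mono ?_
  simp only [Polynomial.eval_add, Polynomial.eval_mul, Polynomial.eval_ofNat,
    Polynomial.eval_one, Polynomial.eval_comp, Polynomial.eval_X, Polynomial.eval_pow, ← hm]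
  gcongr
  · omega
  · simp

end StackProgram

namespace StackProgram

/-! ### Functions and predicates defined by expressions -/

/-- Weakening: the expression in an environment with a new variable inserted at position `c`. -/
def Expr.lift : ℕ → Expr → Expr
  | _, .lit n => .lit n
  | c, .var i => .var (if i < c then i else i + 1)
  | c, .add a b => .add (a.lift c) (b.lift c)
  | c, .sub a b => .sub (a.lift c) (b.lift c)
  | c, .sum n b => .sum (n.lift c) (b.lift (c + 1))
  | c, .iter n k b => .iter (n.lift c) (k.lift c) (b.lift (c + 1))
  | c, .mem a => .mem (a.lift c)
  | c, .vis a => .vis (a.lift c)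

/-- Erasing position `c` keeps the variables below `c` and shifts the others by one; under a binder
`c` becomes `c + 1`. -/
theorem Expr.eval_lift (M V : List ℕ) (e : Expr) :
    ∀ (c : ℕ) (E : List ℕ), (e.lift c).eval M V E = e.eval M V (E.eraseIdx c) := by
  induction e with
  | lit n => exact fun _ _ => rfl
  | var i =>
    intro c E
    simp only [Expr.lift, Expr.eval, List.getD_eq_getElem?_getD, List.getElem?_eraseIdx]
    split_ifs <;> rfl
  | add a b iha ihb => intro c E; simp only [Expr.lift, Expr.eval, iha, ihb]
  | sub a b iha ihb => intro c E; simp only [Expr.lift, Expr.eval, iha, ihb]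
  | sum n b ihn ihb =>
    intro c E; simp only [Expr.lift, Expr.eval, ihn, ihb, List.eraseIdx_cons_succ]
  | iter n k b ihn ihk ihb =>
    intro c E; simp only [Expr.lift, Expr.eval, ihn, ihk, ihb, List.eraseIdx_cons_succ]
  | mem a iha => intro c E; simp only [Expr.lift, Expr.eval, iha]
  | vis a iha => intro c E; simp only [Expr.lift, Expr.eval, iha]

/-- The two tables and the values of the variables. -/
structure Context where
  mem : List ℕ
  vis : List ℕ
  env : List ℕ

/-- The value of the innermost variable. -/
def Context.head (c : Context) : ℕ := c.env.getD 0 0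

/-- Forgetting the innermost variable. -/
def Context.tail (c : Context) : Context := ⟨c.mem, c.vis, c.env.tail⟩

/-- Functions given by an expression. -/
def Definable (f : Context → ℕ) : Prop :=
  ∃ e : Expr, ∀ M V E, e.eval M V E = f ⟨M, V, E⟩

open scoped Classical in
/-- Predicates whose characteristic function is given by an expression. -/
def DefinablePred (p : Context → Prop) : Prop := Definable fun c => if p c then 1 else 0

variable {f g h : Context → ℕ} {p q : Context → Prop}

theorem Definable.const (n : ℕ) : Definable fun _ => n := ⟨.lit n, fun _ _ _ => rfl⟩

theorem Definable.var (i : ℕ) : Definable fun c => c.env.getD i 0 := ⟨.var i, fun _ _ _ => rfl⟩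

theorem Definable.head : Definable Context.head := .var 0

theorem Definable.tail (hf : Definable f) : Definable fun c => f c.tail := by
  obtain ⟨e, he⟩ := hf
  exact ⟨e.lift 0, fun M V E => by
    rw [Expr.eval_lift, he, List.eraseIdx_zero]; rfl⟩

theorem Definable.add (hf : Definable f) (hg : Definable g) : Definable fun c => f c + g c := by
  obtain ⟨e, he⟩ := hf
  obtain ⟨e', he'⟩ := hg
  exact ⟨.add e e', fun M V E => by rw [Expr.eval, he, he']⟩

theorem Definable.sub (hf : Definable f) (hg : Definable g) : Definable fun c => f c - g c := by
  obtain ⟨e, he⟩ := hf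
  obtain ⟨e', he'⟩ := hg
  exact ⟨.sub e e', fun M V E => by rw [Expr.eval, he, he']⟩

theorem Definable.mem (hf : Definable f) : Definable fun c => c.mem.getD (f c) 0 := by
  obtain ⟨e, he⟩ := hf
  exact ⟨.mem e, fun M V E => by rw [Expr.eval, he]⟩

theorem Definable.vis (hf : Definable f) : Definable fun c => c.vis.getD (f c) 0 := by
  obtain ⟨e, he⟩ := hf
  exact ⟨.vis e, fun M V E => by rw [Expr.eval, he]⟩

theorem Definable.sum {g : ℕ → Context → ℕ} (hf : Definable f)
    (hg : Definable fun c => g c.head c.tail) :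
    Definable fun c => ∑ i ∈ Finset.range (f c), g i c := by
  obtain ⟨e, he⟩ := hf
  obtain ⟨e', he'⟩ := hg
  exact ⟨.sum e e', fun M V E => by
    rw [Expr.eval, he]; exact Finset.sum_congr rfl fun i _ => he' M V (i :: E)⟩

theorem Definable.iterate {g : ℕ → Context → ℕ} (hf : Definable f) (hh : Definable h)
    (hg : Definable fun c => g c.head c.tail) :
    Definable fun c => (fun x => min (g x c) (h c))^[f c] 0 := by
  obtain ⟨e, he⟩ := hf
  obtain ⟨e', he'⟩ := hg
  obtain ⟨e'', he''⟩ := hh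
  refine ⟨.iter e e'' e', fun M V E => ?_⟩
  rw [Expr.eval, he, he'']
  congr 1
  funext x
  rw [he']
  rfl

theorem Definable.mul (hf : Definable f) (hg : Definable g) : Definable fun c => f c * g c := by
  have := hf.sum (g := fun _ c => g c) hg.tail
  simpa using this

theorem Definable.pow (hf : Definable f) (n : ℕ) : Definable fun c => f c ^ n := by
  induction n with
  | zero => simpa using Definable.const 1
  | succ n ih => simpa only [pow_succ] using ih.mul hf

theorem DefinablePred.ite [∀ c, Decidable (p c)] (hp : DefinablePred p) :
    Definable fun c => if p c then 1 else 0 := by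
  unfold DefinablePred at hp
  convert hp

theorem DefinablePred.le (hf : Definable f) (hg : Definable g) :
    DefinablePred fun c => f c ≤ g c := by
  have := (Definable.const 1).sub (hf.sub hg)
  unfold DefinablePred
  convert this using 2 with c
  split_ifs <;> omega

theorem DefinablePred.not (hp : DefinablePred p) : DefinablePred fun c => ¬ p c := by
  have := (Definable.const 1).sub hp
  unfold DefinablePred
  convert this using 2 with c
  by_cases hc : p c <;> simp [hc]

theorem DefinablePred.and (hp : DefinablePred p) (hq : DefinablePred q) :
    DefinablePred fun c => p c ∧ q c := by
  have := Definable.mul hp hq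
  unfold DefinablePred
  convert this using 2 with c
  by_cases hc : p c <;> by_cases hd : q c <;> simp [hc, hd]

theorem DefinablePred.or (hp : DefinablePred p) (hq : DefinablePred q) :
    DefinablePred fun c => p c ∨ q c := by
  have := (hp.not.and hq.not).not
  simpa only [not_and_or, not_not] using this

theorem DefinablePred.eq (hf : Definable f) (hg : Definable g) :
    DefinablePred fun c => f c = g c := by
  simpa only [← le_antisymm_iff] using (DefinablePred.le hf hg).and (DefinablePred.le hg hf)

/-- A bounded sum of characteristic values is nonzero exactly if one of them is. -/
theorem DefinablePred.exists_lt {p : ℕ → Context → Prop} (hf : Definable f)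
    (hp : DefinablePred fun c => p c.head c.tail) :
    DefinablePred fun c => ∃ i < f c, p i c := by
  classical
  have h1 : Definable fun c => ∑ i ∈ Finset.range (f c), if p i c then 1 else 0 :=
    Definable.sum (g := fun i c => if p i c then 1 else 0) hf hp.ite
  have h2 := (DefinablePred.eq h1 (Definable.const 0)).not
  have h3 : (fun c => ¬ (∑ i ∈ Finset.range (f c), if p i c then 1 else 0) = 0) =
      fun c => ∃ i < f c, p i c := by
    funext c
    simp
  rwa [h3] at h2

/-- The quotient counts the `i < f c` with `(i + 1) * g c ≤ f c`. The condition `1 ≤ g c` makes the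
count `0` for a zero divisor, in accordance with division on `ℕ`. -/
theorem Definable.div (hf : Definable f) (hg : Definable g) : Definable fun c => f c / g c := by
  classical
  have hp : DefinablePred fun c : Context => 1 ≤ g c.tail ∧ (c.head + 1) * g c.tail ≤ f c.tail :=
    (DefinablePred.le (.const 1) hg.tail).and
      (DefinablePred.le ((Definable.head.add (.const 1)).mul hg.tail) hf.tail)
  have h1 : Definable fun c => ∑ i ∈ Finset.range (f c),
      if 1 ≤ g c ∧ (i + 1) * g c ≤ f c then 1 else 0 :=
    Definable.sum (g := fun i c => if 1 ≤ g c ∧ (i + 1) * g c ≤ f c then 1 else 0) hf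
      hp.ite
  convert h1 using 2 with c
  rcases Nat.eq_zero_or_pos (g c) with h0 | h0
  · simp [h0]
  · rw [← Finset.sum_filter, Finset.sum_const, smul_eq_mul, mul_one]
    have : Finset.filter (fun i => 1 ≤ g c ∧ (i + 1) * g c ≤ f c) (Finset.range (f c)) =
        Finset.range (f c / g c) := by
      ext i
      simp only [Finset.mem_filter, Finset.mem_range, ← Nat.le_div_iff_mul_le h0]
      have := Nat.div_le_self (f c) (g c)
      omega
    rw [this, Finset.card_range]

theorem Definable.mod (hf : Definable f) (hg : Definable g) : Definable fun c => f c % g c := by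
  simpa only [← Nat.mod_eq_sub_mul_div] using hf.sub (hg.mul (hf.div hg))

end StackProgram

/-! ### Periodic words -/

namespace Stream'

variable {A : Type}

theorem take_add_eq_append (w : Stream' A) (m n : ℕ) :
    w.take (m + n) = w.take m ++ (w.drop m).take n := by
  induction n with
  | zero => simp
  | succ n ih =>
    rw [← Nat.add_assoc, take_succ', ih, take_succ', get_drop, List.append_assoc]

theorem drop_mul_eq_self {w : Stream' A} {P : ℕ} (hw : w.drop P = w) (n : ℕ) :
    w.drop (P * n) = w := by
  induction n with
  | zero => rfl
  | succ n ih => rw [Nat.mul_succ, Nat.add_comm, ← drop_drop, hw, ih]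

theorem foldl_take_mul {S : Type} (f : S → A → S) {w : Stream' A} {P : ℕ} (hw : w.drop P = w)
    (n : ℕ) (s : S) :
    (w.take (P * n)).foldl f s = (fun s => (w.take P).foldl f s)^[n] s := by
  induction n generalizing s with
  | zero => rfl
  | succ n ih =>
    rw [Nat.mul_succ, Nat.add_comm, take_add_eq_append, hw, List.foldl_append, ih,
      Function.iterate_succ_apply]

/-- The equation forces the prefix of length `x.length * m` to consist of `m` copies of `x`, for
every `m`. -/
theorem eq_of_eq_append {x : List A} (hx : x ≠ []) {v w : Stream' A} (hv : v = x ++ₛ v)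
    (hw : w = x ++ₛ w) : v = w := by
  have hlen : 0 < x.length := List.length_pos_iff.2 hx
  have hd : ∀ {t : Stream' A}, t = x ++ₛ t → t.drop x.length = t := fun {t} ht => by
    conv_lhs => rw [ht]
    exact drop_append_stream x t
  have ht : ∀ {t : Stream' A}, t = x ++ₛ t → t.take x.length = x := fun {t} ht => by
    rw [ht, take_append_of_le_length _ _ _ le_rfl, List.take_length]
  refine take_theorem _ _ fun n => ?_
  have key : ∀ m, v.take (x.length * m) = w.take (x.length * m) := by
    intro m
    induction m with
    | zero => rfl
    | succ m ih =>
      rw [Nat.mul_succ, Nat.add_comm, take_add_eq_append, take_add_eq_append, hd hv, hd hw, ih,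
        ht hv, ht hw]
  have hn : n ≤ x.length * n := Nat.le_mul_of_pos_left n hlen
  have := congrArg (List.take n) (key n)
  rwa [take_take, take_take, min_eq_right hn] at this

theorem drop_cycle (x : List A) (hx : x ≠ []) : (cycle x hx).drop x.length = cycle x hx := by
  conv_lhs => rw [cycle_eq]
  exact drop_append_stream x _

theorem take_cycle (x : List A) (hx : x ≠ []) : (cycle x hx).take x.length = x := by
  rw [cycle_eq, take_append_of_le_length _ _ _ le_rfl, List.take_length]

/-- Both sides solve `v = (z ++ [a]) ++ₛ v`. This is the rotation of a period by one letter. -/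
theorem tail_cycle_cons (a : A) (z : List A) :
    (cycle (a :: z) (List.cons_ne_nil a z)).tail = cycle (z ++ [a]) (by simp) := by
  have hc := cycle_eq (a :: z) (List.cons_ne_nil a z)
  set v := cycle (a :: z) (List.cons_ne_nil a z)
  rw [cons_append_stream] at hc
  have ht : v.tail = z ++ₛ v := by
    conv_lhs => rw [hc]
    rfl
  refine eq_of_eq_append (x := z ++ [a]) (by simp) ?_ (cycle_eq _ _)
  rw [append_append_stream, ht]
  congr 1

end Stream'

/-- Some iterate of a self-map of a finite type is idempotent. -/
theorem exists_iterate_idempotent {X : Type} [Finite X] (f : X → X) :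
    ∃ N, 0 < N ∧ ∀ s, f^[N] (f^[N] s) = f^[N] s := by
  obtain ⟨i, j, hij, h⟩ := Finite.exists_ne_map_eq_of_infinite fun n : ℕ => f^[n]
  wlog hlt : i < j generalizing i j
  · exact this j i hij.symm h.symm (by omega)
  obtain ⟨d, rfl⟩ : ∃ d, j = i + d := ⟨j - i, by omega⟩
  have hd : 0 < d := by omega
  have hper : ∀ n m, i ≤ n → f^[n + d * m] = f^[n] := by
    intro n m hn
    induction m with
    | zero => rfl
    | succ m ih =>
      obtain ⟨k, rfl⟩ : ∃ k, n = i + k := ⟨n - i, by omega⟩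
      rw [show i + k + d * (m + 1) = (k + d * m) + (i + d) by ring, Function.iterate_add, ← h,
        ← Function.iterate_add, ← ih]
      congr 1
      ring
  -- A positive multiple of the period `d` that is at least the preperiod `i`.
  refine ⟨d * (i + 1), by positivity, fun s => ?_⟩
  rw [← Function.iterate_add_apply, hper _ _ (by nlinarith)]

/-! ### Loops of weak automata -/

namespace DFA

variable {A Q : Type}

/-- The states on a common cycle with `s` form a strongly connected component: it is maximal because
any larger strongly connected set also contains `s`. -/
theorem IsWeak.mem_accept_iff {M : DFA A Q} (hM : M.IsWeak) {s t : Q} {x y : List A}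
    (hx : x ≠ []) (hy : y ≠ []) (hst : M.evalFrom s x = t) (hts : M.evalFrom t y = s) :
    s ∈ M.accept ↔ t ∈ M.accept := by
  set S : Set Q := {v | (∃ x : List A, x ≠ [] ∧ M.evalFrom s x = v) ∧
    ∃ y : List A, y ≠ [] ∧ M.evalFrom v y = s} with hS
  have hsS : s ∈ S := by
    have : M.evalFrom s (x ++ y) = s := by rw [evalFrom_of_append, hst, hts]
    exact ⟨⟨x ++ y, by simp [hx], this⟩, ⟨x ++ y, by simp [hx], this⟩⟩
  have htS : t ∈ S := ⟨⟨x, hx, hst⟩, ⟨y, hy, hts⟩⟩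
  have hscc : M.IsSCC S := by
    refine ⟨⟨s, hsS⟩, ?_, ?_⟩
    · rintro p ⟨_, y, hy, hp⟩ q ⟨⟨x, hx, hq⟩, _⟩
      exact ⟨y ++ x, by simp [hx], by rw [evalFrom_of_append, hp, hq]⟩
    · intro S' hS' hle v hv
      exact ⟨hS' s (hle hsS) v hv, hS' v hv s (hle hsS)⟩
  rcases hM S hscc with h | h
  · exact ⟨fun _ => h t htS, fun _ => h s hsS⟩
  · exact ⟨fun hs => absurd hs (h s hsS), fun ht => absurd ht (h t htS)⟩

/-- A weak automaton that loops at `s` after one period accepts if and only if `s` is final. -/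
theorem IsWeak.buchiAccepts_iff {M : DFA A Q} (hM : M.IsWeak) {w : Stream' A} {P : ℕ}
    (hP : 0 < P) (hw : w.drop P = w) {s : Q} (h₁ : M.evalFrom M.start (w.take P) = s)
    (h₂ : M.evalFrom s (w.take P) = s) : M.BuchiAccepts w ↔ s ∈ M.accept := by
  have hloop : ∀ n, M.evalFrom s (w.take (P * n)) = s := by
    intro n
    have := Stream'.foldl_take_mul M.step hw n s
    refine this.trans ?_
    exact Function.iterate_fixed h₂ n
  have heval : ∀ i, M.eval (w.take (P + i)) = M.evalFrom s (w.take i) := by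
    intro i
    rw [Stream'.take_add_eq_append, hw, DFA.eval, evalFrom_of_append, h₁]
  unfold BuchiAccepts
  rw [Filter.frequently_atTop]
  constructor
  · intro h
    obtain ⟨m, hm, hacc⟩ := h P
    obtain ⟨i, rfl⟩ : ∃ i, m = P + i := ⟨m - P, by omega⟩
    rw [heval] at hacc
    -- The run is prolonged to a multiple of the period, where it is back in `s`; hence the final
    -- state seen at `i` shares a cycle with `s`.
    have hi : i < P * (i + 1) := by nlinarith
    obtain ⟨j, hj⟩ : ∃ j, P * (i + 1) = i + j := ⟨P * (i + 1) - i, by omega⟩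
    have hback := hloop (i + 1)
    rw [hj, Stream'.take_add_eq_append, evalFrom_of_append] at hback
    have hne : ∀ {n : ℕ} {v : Stream' A}, 0 < n → v.take n ≠ [] := by
      intro n v hn h0
      have := congrArg List.length h0
      rw [Stream'.length_take] at this
      simp at this
      omega
    -- A full period is put in front because `w.take i` is empty for `i = 0`.
    refine (hM.mem_accept_iff (x := w.take P ++ w.take i) ?_ (hne (by omega)) ?_ hback).2 hacc
    · simp [hne hP]
    · rw [evalFrom_of_append, h₂]
  · intro hs n
    refine ⟨P + P * n, by nlinarith, ?_⟩
    rw [heval, hloop]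
    exact hs

end DFA

/-! ### Saturation as the absence of a loop -/

namespace AutomataFamily

variable {A Q : Type} {P : Q → Type}

/-- From the state `q` there is a loop `az` of the leading transition system on which the
progress automata of `q` and of its `a`-successor, reading `az` and `za`, stay in a state after
the first round, and exactly one of these states is final. -/
def HasUnstableLoop (F : AutomataFamily A Q P) (q : Q) : Prop :=
  ∃ (a : A) (s : P q) (r : P (F.leading.step q a)) (z : List A),
    z.foldl F.leading.step (F.leading.step q a) = q ∧
    (F.progress q).evalFrom (F.progress q).start (a :: z) = s ∧
    (F.progress q).evalFrom s (a :: z) = s ∧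
    (F.progress _).evalFrom (F.progress _).start (z ++ [a]) = r ∧
    (F.progress _).evalFrom r (z ++ [a]) = r ∧
    ¬ (s ∈ (F.progress q).accept ↔ r ∈ (F.progress _).accept)

/-- Passing to a power of the period makes both automata loop from the end of the first round on. By
weakness the two sides then say whether the looping states are final, so a disagreement would be an
unstable loop at `q`. -/
theorem buchiAccepts_tail_iff {F : AutomataFamily A Q P} [∀ q, Finite (P q)]
    (hF : ∀ q, (F.progress q).IsWeak) {q : Q} (hq : ¬ F.HasUnstableLoop q) {v : Stream' A} {n : ℕ}
    (hn : 0 < n) (hv : v.drop n = v) (hloop : (v.take n).foldl F.leading.step q = q) :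
    (F.progress q).BuchiAccepts v ↔
      (F.progress (F.leading.step q v.head)).BuchiAccepts v.tail := by
  set p := F.leading.step q v.head with hp
  have hvt : v.tail.drop n = v.tail := by
    conv_rhs => rw [← hv]
    rw [Stream'.tail_drop]
  -- Applied to the product of the two state maps, this yields one exponent for both automata.
  obtain ⟨N, hN, hidem⟩ := exists_iterate_idempotent
    (Prod.map (fun s => (v.take n).foldl (F.progress q).step s)
      (fun s => (v.tail.take n).foldl (F.progress p).step s))
  simp only [Prod.map_iterate, Prod.forall, Prod.map_apply, Prod.mk.injEq] at hidem
  simp only [← Stream'.foldl_take_mul _ hv, ← Stream'.foldl_take_mul _ hvt] at hidem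
  have hdv := Stream'.drop_mul_eq_self hv N
  have hdvt := Stream'.drop_mul_eq_self hvt N
  have hloop' : (v.take (n * N)).foldl F.leading.step q = q := by
    rw [Stream'.foldl_take_mul _ hv]
    exact Function.iterate_fixed hloop N
  have hpos : 0 < n * N := by positivity
  set k := n * N with hk
  clear_value k
  obtain ⟨k, rfl⟩ : ∃ m, k = m + 1 := ⟨k - 1, by omega⟩
  have e1 : v.take (k + 1) = v.head :: v.tail.take k := rfl
  have e2 : v.tail.take (k + 1) = v.tail.take k ++ [v.head] := by
    rw [Stream'.take_succ', Stream'.get_tail]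
    congr 2
    conv_rhs => rw [← hdv]
    exact (Stream'.head_drop v (k + 1)).symm
  have hs := hidem (F.progress q).start (F.progress p).start
  rw [(hF q).buchiAccepts_iff hpos hdv rfl hs.1, (hF p).buchiAccepts_iff hpos hdvt rfl hs.2]
  by_contra hne
  refine hq ⟨v.head, _, _, v.tail.take k, ?_, ?_, ?_, ?_, ?_, hne⟩
  · rw [e1] at hloop'; exact hloop'
  · rw [e1]
  · have := hs.1
    rw [e1] at this ⊢; exact this
  · rw [e2]
  · have := hs.2
    rw [e2] at this ⊢; exact this

theorem leading_eval_append (F : AutomataFamily A Q P) (u x : List A) :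
    F.leading.eval (u ++ x) = x.foldl F.leading.step (F.leading.eval u) :=
  List.foldl_append

/-- An unstable loop contradicts saturation through the pairs `(u, az)` and `(ua, za)`. Conversely,
acceptance is carried along the common word to a position beyond both `u` and `v`. -/
theorem omegaSaturated_iff (F : AutomataFamily A Q P) [∀ q, Finite (P q)]
    (hF : ∀ q, (F.progress q).IsWeak) :
    F.OmegaSaturated ↔ ∀ u, ¬ F.HasUnstableLoop (F.leading.eval u) := by
  constructor
  · rintro hsat u ⟨a, s, r, z, hz, hs, hss, hr, hrr, hne⟩
    have hap : F.leading.eval (u ++ [a]) = F.leading.step (F.leading.eval u) a :=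
      leading_eval_append F u [a]
    have h := hsat u (a :: z) (u ++ [a]) (z ++ [a]) (List.cons_ne_nil a z) (by simp)
      (by rw [Normalized, leading_eval_append]; exact hz)
      (by
        rw [Normalized, leading_eval_append, hap, List.foldl_append, hz]; rfl)
      (by
        rw [← Stream'.tail_cycle_cons, Stream'.append_append_stream]
        congr 1
        exact (Stream'.eta _).symm)
    unfold OmegaAccepts at h
    rw [hap, (hF _).buchiAccepts_iff (P := (a :: z).length) (by simp)
        (Stream'.drop_cycle _ _) (s := s) (by rwa [Stream'.take_cycle])
        (by rwa [Stream'.take_cycle]),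
      (hF _).buchiAccepts_iff (P := (z ++ [a]).length) (by simp)
        (Stream'.drop_cycle _ _) (s := r) (by rwa [Stream'.take_cycle])
        (by rwa [Stream'.take_cycle])] at h
    exact hne h
  · intro hno
    have key : ∀ (u x : List A) (hx : x ≠ []) (w : Stream' A), F.Normalized u x →
        u ++ₛ Stream'.cycle x hx = w → ∀ j, u.length ≤ j →
        (F.OmegaAccepts u x hx ↔
          (F.progress (F.leading.eval (w.take j))).BuchiAccepts (w.drop j)) := by
      intro u x hx w hnorm hw j hj
      have hlen : 0 < x.length := List.length_pos_iff.2 hx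
      have hd : w.drop u.length = Stream'.cycle x hx := by
        rw [← hw]; exact Stream'.drop_append_stream u _
      have ht : w.take u.length = u := by
        rw [← hw, Stream'.take_append_of_le_length _ _ _ le_rfl, List.take_length]
      -- The induction on `j` also carries the periodicity of the suffix and the loop of the leading
      -- state, which `buchiAccepts_tail_iff` needs for the next shift.
      suffices h : (w.drop j).drop x.length = w.drop j ∧
          ((w.drop j).take x.length).foldl F.leading.step (F.leading.eval (w.take j)) =
            F.leading.eval (w.take j) ∧ (F.OmegaAccepts u x hx ↔
          (F.progress (F.leading.eval (w.take j))).BuchiAccepts (w.drop j)) from h.2.2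
      induction j, hj using Nat.le_induction with
      | base =>
        rw [hd, ht, Stream'.drop_cycle, Stream'.take_cycle]
        refine ⟨rfl, ?_, Iff.rfl⟩
        rw [← leading_eval_append]
        exact hnorm
      | succ j hj ih =>
        obtain ⟨i1, i2, i3⟩ := ih
        have hstep : F.leading.eval (w.take (j + 1)) =
            F.leading.step (F.leading.eval (w.take j)) (w.drop j).head := by
          rw [Stream'.take_succ', leading_eval_append, Stream'.head_drop]; rfl
        have htail : w.drop (j + 1) = (w.drop j).tail := Stream'.tail_drop'.symm
        have hget : (w.drop j).get x.length = (w.drop j).head := by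
          conv_rhs => rw [← i1]
          exact (Stream'.head_drop _ _).symm
        refine ⟨?_, ?_, ?_⟩
        · rw [htail, ← Stream'.tail_drop, i1]
        · have e : (w.drop j).head :: (w.drop j).tail.take x.length =
              (w.drop j).take x.length ++ [(w.drop j).head] := by
            rw [← hget, ← Stream'.take_succ', hget]; rfl
          have := congrArg (fun l => List.foldl F.leading.step (F.leading.eval (w.take j)) l) e
          simp only [List.foldl_append, List.foldl_cons, List.foldl_nil, i2] at this
          rw [hstep, htail, this]
        · rw [i3, hstep, htail]
          exact buchiAccepts_tail_iff hF (hno _) hlen i1 i2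
    intro u x v y hx hy hnu hnv heq
    rw [key u x hx _ hnu rfl (max u.length v.length) (le_max_left _ _),
      key v y hy _ hnv heq.symm (max u.length v.length) (le_max_right _ _)]

end AutomataFamily

/-! ### Reading the description of a family -/

namespace List

variable {β : Type}

/-- The blocks may differ in length, as the descriptions of the progress automata do. -/
theorem getD_flatMap_finRange {n : ℕ} (f : Fin n → List β) (q : Fin n) {j : ℕ}
    (hj : j < (f q).length) (d : β) :
    ((finRange n).flatMap f).getD ((((finRange n).take q).flatMap f).length + j) d =
      (f q).getD j d := by
  have hq : (q : ℕ) < (finRange n).length := by simp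
  have h : finRange n = (finRange n).take q ++ q :: (finRange n).drop (q + 1) := by
    conv_lhs => rw [← take_append_drop q (finRange n), drop_eq_getElem_cons hq]
    simp
  conv_lhs => rw [h, flatMap_append, flatMap_cons]
  rw [← h, getD_append_right _ _ _ _ (by omega), Nat.add_sub_cancel_left, getD_append _ _ _ _ hj]

theorem length_flatMap_take_succ {n : ℕ} (f : Fin n → List β) (q : Fin n) :
    (((finRange n).take (q + 1)).flatMap f).length =
      (((finRange n).take q).flatMap f).length + (f q).length := by
  have hq : (q : ℕ) < (finRange n).length := by simp
  rw [take_succ_eq_append_getElem hq, flatMap_append, length_append]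
  simp

theorem length_flatMap_take_of_forall {n m : ℕ} (f : Fin n → List β)
    (hf : ∀ i, (f i).length = m) {q : ℕ} (hq : q ≤ n) :
    (((finRange n).take q).flatMap f).length = q * m := by
  induction q with
  | zero => simp
  | succ q ih =>
    rw [length_flatMap_take_succ f ⟨q, hq⟩, hf, ih (by omega), Nat.succ_mul]

theorem length_flatMap_finRange {n m : ℕ} (f : Fin n → List β) (hf : ∀ i, (f i).length = m) :
    ((finRange n).flatMap f).length = n * m := by
  have := length_flatMap_take_of_forall f hf le_rfl
  rwa [take_of_length_le (by simp)] at this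

theorem getD_flatMap_map_finRange {n m : ℕ} (g : Fin n → Fin m → β) (q : Fin n) (a : Fin m)
    (d : β) :
    ((finRange n).flatMap fun q => (finRange m).map (g q)).getD (q * m + a) d = g q a := by
  have h := getD_flatMap_finRange (fun q => (finRange m).map (g q)) q (j := a) (by simp) d
  rw [length_flatMap_take_of_forall _ (m := m) (by simp) q.2.le] at h
  rw [h, getD_eq_getElem _ _ (by simp)]
  simp

end List

namespace FDWA

open StackProgram

/-- The number of letters. -/
def lettersAt (M : List ℕ) : ℕ := M.getD 0 0

/-- The position of the first progress automaton. -/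
def baseAt (M : List ℕ) : ℕ := 3 + M.getD 1 0 * lettersAt M

/-- The transition function of the leading transition system. -/
def leadingStepAt (M : List ℕ) (q a : ℕ) : ℕ := M.getD (3 + (q * lettersAt M + a)) 0

/-- The position of the progress automaton of `q`. -/
def offsetAt (M : List ℕ) (L q : ℕ) : ℕ :=
  baseAt M +
    (fun x => min (x + (2 + M.getD (baseAt M + x) 0 * (lettersAt M + 1))) L)^[q] 0

/-- The number of states of the progress automaton of `q`. -/
def sizeAt (M : List ℕ) (L q : ℕ) : ℕ := M.getD (offsetAt M L q) 0

/-- The initial state of the progress automaton of `q`. -/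
def startAt (M : List ℕ) (L q : ℕ) : ℕ := M.getD (offsetAt M L q + 1) 0

/-- The transition function of the progress automaton of `q`. -/
def stepAt (M : List ℕ) (L q s a : ℕ) : ℕ :=
  M.getD (offsetAt M L q + (2 + (s * lettersAt M + a))) 0

/-- The acceptance bits of the progress automaton of `q`. -/
def acceptAt (M : List ℕ) (L q s : ℕ) : ℕ :=
  M.getD (offsetAt M L q + (2 + (sizeAt M L q * lettersAt M + s))) 0

theorem length_progressNumbers {m k : ℕ} (M : DFA (Fin m) (Fin k)) :
    (progressNumbers M).length = 2 + k * (m + 1) := by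
  rw [progressNumbers, List.length_append, List.length_cons, List.length_cons,
    List.length_flatMap_finRange _ (m := m) (by simp), List.length_map, List.length_finRange]
  ring

variable (W : FDWA)

theorem encode_eq_unary : W.encode = unary W.numbers := rfl

/-- The inequality is strict because of the closing bit. Hence letters and states can be digits to
the base `W.encode.length`. -/
theorem lt_length_encode {x : ℕ} (h : x ∈ W.numbers) : x < W.encode.length :=
  lt_length_unary h

theorem letters_lt : W.letters < W.encode.length := W.lt_length_encode (by simp [numbers])

theorem leadingSize_lt : W.leadingSize < W.encode.length :=
  W.lt_length_encode (by simp [numbers])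

theorem progressSize_lt (q : Fin W.leadingSize) : W.progressSize q < W.encode.length := by
  refine W.lt_length_encode (List.mem_append_right _ (List.mem_flatMap.2 ⟨q, by simp, ?_⟩))
  simp [progressNumbers]

@[simp] theorem lettersAt_numbers : lettersAt W.numbers = W.letters := rfl

@[simp] theorem baseAt_numbers : baseAt W.numbers = 3 + W.leadingSize * W.letters := rfl

theorem getD_numbers_leading (j : ℕ) (hj : j < W.leadingSize * W.letters) :
    W.numbers.getD (3 + j) 0 = ((List.finRange W.leadingSize).flatMap fun q =>
      (List.finRange W.letters).map fun a => (W.family.leading.step q a).val).getD j 0 := by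
  have hl := List.length_flatMap_finRange (fun q : Fin W.leadingSize =>
      (List.finRange W.letters).map fun a => (W.family.leading.step q a).val)
      (m := W.letters) (by simp)
  rw [numbers, List.getD_append _ _ _ _ (by simp only [List.length_cons, hl]; omega),
    Nat.add_comm 3 j]
  rfl

theorem getD_numbers_progress (j : ℕ) :
    W.numbers.getD (3 + W.leadingSize * W.letters + j) 0 =
      ((List.finRange W.leadingSize).flatMap fun q =>
        progressNumbers (W.family.progress q)).getD j 0 := by
  have hl := List.length_flatMap_finRange (fun q : Fin W.leadingSize =>
      (List.finRange W.letters).map fun a => (W.family.leading.step q a).val)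
      (m := W.letters) (by simp)
  rw [numbers, List.getD_append_right _ _ _ _ (by simp only [List.length_cons, hl]; omega)]
  simp only [List.length_cons, hl]
  congr 1
  omega

@[simp] theorem leadingStepAt_numbers (q : Fin W.leadingSize) (a : Fin W.letters) :
    leadingStepAt W.numbers q a = W.family.leading.step q a := by
  have h : (q : ℕ) * W.letters + a < W.leadingSize * W.letters := by
    have := Nat.mul_le_mul_right W.letters (Nat.succ_le_of_lt q.2)
    have := a.2
    rw [Nat.succ_mul] at *
    omega
  rw [leadingStepAt, lettersAt_numbers, getD_numbers_leading W _ h]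
  exact List.getD_flatMap_map_finRange
    (fun q a => (W.family.leading.step q a).val) q a 0

/-- The position of the progress automaton of `q` relative to the first one. -/
noncomputable def relOffset (q : ℕ) : ℕ :=
  (((List.finRange W.leadingSize).take q).flatMap fun q =>
    progressNumbers (W.family.progress q)).length

theorem getD_numbers_relOffset (q : Fin W.leadingSize) {j : ℕ}
    (hj : j < 2 + W.progressSize q * (W.letters + 1)) :
    W.numbers.getD (3 + W.leadingSize * W.letters + W.relOffset q + j) 0 =
      (progressNumbers (W.family.progress q)).getD j 0 := by
  rw [Nat.add_assoc (3 + W.leadingSize * W.letters), getD_numbers_progress]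
  exact List.getD_flatMap_finRange (fun q => progressNumbers (W.family.progress q)) q
    (by rwa [length_progressNumbers]) 0

theorem relOffset_succ (q : Fin W.leadingSize) :
    W.relOffset (q + 1) = W.relOffset q + (2 + W.progressSize q * (W.letters + 1)) := by
  rw [relOffset, List.length_flatMap_take_succ, length_progressNumbers]
  rfl

theorem relOffset_le (q : ℕ) : W.relOffset q ≤ W.encode.length := by
  refine le_trans ?_ (length_le_length_unary W.numbers)
  rw [numbers, List.length_append]
  refine le_add_left ?_
  exact ((List.take_sublist q _).flatMap _).length_le

/-- Each block starts with its number of states, which determines its length, so `q` blocks are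
skipped by iteration. The cap needed for the time bound has no effect here, as positions inside the
description never exceed the length of the encoding. -/
theorem offsetAt_numbers (q : Fin W.leadingSize) :
    offsetAt W.numbers W.encode.length q = 3 + W.leadingSize * W.letters + W.relOffset q := by
  have key : ∀ i ≤ W.leadingSize, (fun x => min (x + (2 + W.numbers.getD
      (baseAt W.numbers + x) 0 * (lettersAt W.numbers + 1))) W.encode.length)^[i] 0 =
      W.relOffset i := by
    intro i hi
    induction i with
    | zero => simp [relOffset]
    | succ i ih =>
      rw [Function.iterate_succ_apply', ih (by omega)]
      have h := W.getD_numbers_relOffset ⟨i, hi⟩ (j := 0) (by omega)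
      have h' : (progressNumbers (W.family.progress ⟨i, hi⟩)).getD 0 0 =
        W.progressSize ⟨i, hi⟩ := rfl
      rw [h', Nat.add_zero] at h
      have h2 := W.relOffset_succ ⟨i, hi⟩
      simp only at h h2
      rw [baseAt_numbers, lettersAt_numbers, h, ← h2, min_eq_left (W.relOffset_le _)]
  rw [offsetAt, key q q.2.le, baseAt_numbers]

@[simp] theorem sizeAt_numbers (q : Fin W.leadingSize) :
    sizeAt W.numbers W.encode.length q = W.progressSize q := by
  rw [sizeAt, offsetAt_numbers]
  exact W.getD_numbers_relOffset q (j := 0) (by omega)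

@[simp] theorem startAt_numbers (q : Fin W.leadingSize) :
    startAt W.numbers W.encode.length q = (W.family.progress q).start := by
  rw [startAt, offsetAt_numbers]
  exact W.getD_numbers_relOffset q (j := 1) (by omega)

@[simp] theorem stepAt_numbers (q : Fin W.leadingSize) (s : Fin (W.progressSize q))
    (a : Fin W.letters) :
    stepAt W.numbers W.encode.length q s a = (W.family.progress q).step s a := by
  have h : (s : ℕ) * W.letters + a < W.progressSize q * W.letters := by
    have := Nat.mul_le_mul_right W.letters (Nat.succ_le_of_lt s.2)
    have := a.2
    rw [Nat.succ_mul] at *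
    omega
  have hl := List.length_flatMap_finRange (fun s : Fin (W.progressSize q) =>
      (List.finRange W.letters).map fun a => ((W.family.progress q).step s a).val)
      (m := W.letters) (by simp)
  rw [stepAt, offsetAt_numbers, lettersAt_numbers,
    W.getD_numbers_relOffset q (by rw [Nat.mul_succ]; omega), progressNumbers,
    List.getD_append _ _ _ _ (by simp only [List.length_cons, hl]; omega), Nat.add_comm 2]
  exact List.getD_flatMap_map_finRange
    (fun s a => ((W.family.progress q).step s a).val) s a 0

open scoped Classical in
@[simp] theorem acceptAt_numbers (q : Fin W.leadingSize) (s : Fin (W.progressSize q)) :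
    acceptAt W.numbers W.encode.length q s =
      if s ∈ (W.family.progress q).accept then 1 else 0 := by
  have hl := List.length_flatMap_finRange (fun s : Fin (W.progressSize q) =>
      (List.finRange W.letters).map fun a => ((W.family.progress q).step s a).val)
      (m := W.letters) (by simp)
  rw [acceptAt, sizeAt_numbers, offsetAt_numbers, lettersAt_numbers,
    W.getD_numbers_relOffset q (by rw [Nat.mul_succ]; omega), progressNumbers,
    List.getD_append_right _ _ _ _ (by simp only [List.length_cons, hl]; omega)]
  simp only [List.length_cons, hl]
  rw [show 2 + (W.progressSize q * W.letters + s) - (W.progressSize q * W.letters + 1 + 1) = s by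
    omega, List.getD_eq_getElem _ _ (by simp)]
  simp

end FDWA

namespace FDWA

open StackProgram

/-! ### Searching for an unstable loop -/

/-- The digits of `x` with respect to the base `B`. -/
def digit (B i x : ℕ) : ℕ := x / B ^ i % B

theorem digit_ofDigits {B : ℕ} {l : List ℕ} (h : ∀ d ∈ l, d < B) (i : ℕ) :
    digit B i (Nat.ofDigits B l) = l.getD i 0 := by
  unfold digit
  induction l generalizing i with
  | nil => simp
  | cons d l ih =>
    have hd : d < B := h d List.mem_cons_self
    have hB : 0 < B := by omega
    have hdiv : (d + B * Nat.ofDigits B l) / B = Nat.ofDigits B l := by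
      rw [Nat.add_mul_div_left _ _ hB, Nat.div_eq_of_lt hd, Nat.zero_add]
    rw [Nat.ofDigits_cons]
    cases i with
    | zero => simp [Nat.mod_eq_of_lt hd]
    | succ i =>
      rw [pow_succ', ← Nat.div_div_eq_div_mul, hdiv,
        ih fun d hd => h d (List.mem_cons_of_mem _ hd)]
      rfl

/-- The nodes of the search: `i` is `0` while a leading state `q` is looked for and `1` while the
period is read. In the latter case `a` is the first letter of the period, `s` and `r` are the
states that are to be looping, and the remaining numbers are current states: `t` of the leading
transition system, `s₁` and `s₂` of the progress automaton of `q`, and `r₁` and `r₂` of that of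
its `a`-successor. -/
def node (B i q a s r t s₁ s₂ r₁ r₂ : ℕ) : ℕ :=
  Nat.ofDigits B [i, q, a, s, r, t, s₁, s₂, r₁, r₂]

/-- Successors of the nodes with `i = 0`. -/
def Enter (M : List ℕ) (L : ℕ) (v : ℕ → Prop) (q : ℕ) : Prop :=
  (∃ b < lettersAt M, v (node L 0 (leadingStepAt M q b) 0 0 0 0 0 0 0 0)) ∨
  ∃ a < lettersAt M, ∃ s < sizeAt M L q, ∃ r < sizeAt M L (leadingStepAt M q a),
    ¬ acceptAt M L q s = acceptAt M L (leadingStepAt M q a) r ∧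
    v (node L 1 q a s r (leadingStepAt M q a) (stepAt M L q (startAt M L q) a)
      (stepAt M L q s a) (startAt M L (leadingStepAt M q a)) r)

/-- Successors of the nodes with `i = 1`, and the condition for the end of the search. -/
def Traverse (M : List ℕ) (L : ℕ) (v : ℕ → Prop) (q a s r t s₁ s₂ r₁ r₂ : ℕ) : Prop :=
  (t = q ∧ s₁ = s ∧ s₂ = s ∧ stepAt M L (leadingStepAt M q a) r₁ a = r ∧
    stepAt M L (leadingStepAt M q a) r₂ a = r) ∨
  ∃ b < lettersAt M, v (node L 1 q a s r (leadingStepAt M t b) (stepAt M L q s₁ b)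
    (stepAt M L q s₂ b) (stepAt M L (leadingStepAt M q a) r₁ b)
    (stepAt M L (leadingStepAt M q a) r₂ b))

/-- The node `x` ends the search or has a successor satisfying `v`. -/
def Search (M : List ℕ) (L : ℕ) (v : ℕ → Prop) (x : ℕ) : Prop :=
  (digit L 0 x = 0 ∧ Enter M L v (digit L 1 x)) ∨
  (digit L 0 x = 1 ∧ Traverse M L v (digit L 1 x) (digit L 2 x) (digit L 3 x) (digit L 4 x)
    (digit L 5 x) (digit L 6 x) (digit L 7 x) (digit L 8 x) (digit L 9 x))

/-- The predicate `v` occurs only positively; this makes the backward search monotone. -/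
theorem Search.mono {M : List ℕ} {L : ℕ} {v v' : ℕ → Prop} (h : ∀ y, v y → v' y) {x : ℕ}
    (hx : Search M L v x) : Search M L v' x := by
  rcases hx with ⟨h0, ⟨b, hb, hv⟩ | ⟨a, ha, s, hs, r, hr, hne, hv⟩⟩ | ⟨h0, h1 | ⟨b, hb, hv⟩⟩
  · exact Or.inl ⟨h0, Or.inl ⟨b, hb, h _ hv⟩⟩
  · exact Or.inl ⟨h0, Or.inr ⟨a, ha, s, hs, r, hr, hne, h _ hv⟩⟩
  · exact Or.inr ⟨h0, Or.inl h1⟩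
  · exact Or.inr ⟨h0, Or.inr ⟨b, hb, h _ hv⟩⟩

/-! ### Definability of the search -/

section definable

variable {L q a s r t s₁ s₂ r₁ r₂ x : Context → ℕ}

theorem definable_lettersAt : Definable fun c => lettersAt c.mem := Definable.mem (.const 0)

theorem definable_baseAt : Definable fun c => baseAt c.mem :=
  (Definable.const 3).add ((Definable.mem (.const 1)).mul definable_lettersAt)

theorem definable_leadingStepAt (hq : Definable q) (ha : Definable a) :
    Definable fun c => leadingStepAt c.mem (q c) (a c) :=
  Definable.mem ((Definable.const 3).add ((hq.mul definable_lettersAt).add ha))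

theorem definable_offsetAt (hL : Definable L) (hq : Definable q) :
    Definable fun c => offsetAt c.mem (L c) (q c) :=
  definable_baseAt.add (Definable.iterate
    (g := fun x c => x + (2 + c.mem.getD (baseAt c.mem + x) 0 * (lettersAt c.mem + 1))) hq hL
    (Definable.head.add ((Definable.const 2).add ((Definable.mem
      (definable_baseAt.add .head)).mul (definable_lettersAt.add (.const 1))))))

theorem definable_sizeAt (hL : Definable L) (hq : Definable q) :
    Definable fun c => sizeAt c.mem (L c) (q c) :=
  Definable.mem (definable_offsetAt hL hq)

theorem definable_startAt (hL : Definable L) (hq : Definable q) :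
    Definable fun c => startAt c.mem (L c) (q c) :=
  Definable.mem ((definable_offsetAt hL hq).add (.const 1))

theorem definable_stepAt (hL : Definable L) (hq : Definable q) (hs : Definable s)
    (ha : Definable a) : Definable fun c => stepAt c.mem (L c) (q c) (s c) (a c) :=
  Definable.mem ((definable_offsetAt hL hq).add ((Definable.const 2).add
    ((hs.mul definable_lettersAt).add ha)))

theorem definable_acceptAt (hL : Definable L) (hq : Definable q) (hs : Definable s) :
    Definable fun c => acceptAt c.mem (L c) (q c) (s c) :=
  Definable.mem ((definable_offsetAt hL hq).add ((Definable.const 2).add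
    (((definable_sizeAt hL hq).mul definable_lettersAt).add hs)))

theorem definable_digit (hL : Definable L) (i : ℕ) (hx : Definable x) :
    Definable fun c => digit (L c) i (x c) :=
  (hx.div (hL.pow i)).mod hL

theorem definable_ofDigits (hL : Definable L) :
    ∀ {l : List (Context → ℕ)}, (∀ f ∈ l, Definable f) →
      Definable fun c => Nat.ofDigits (L c) (l.map fun f => f c)
  | [], _ => Definable.const 0
  | f :: _, h => (h f List.mem_cons_self).add
      (hL.mul (definable_ofDigits hL fun g hg => h g (List.mem_cons_of_mem _ hg)))

/-- The bits of the table `vis`. -/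
theorem definablePred_vis_node {i : Context → ℕ} (hL : Definable L) (hi : Definable i)
    (hq : Definable q) (ha : Definable a) (hs : Definable s) (hr : Definable r) (ht : Definable t)
    (hs₁ : Definable s₁) (hs₂ : Definable s₂) (hr₁ : Definable r₁) (hr₂ : Definable r₂) :
    DefinablePred fun c => ¬ c.vis.getD (node (L c) (i c) (q c) (a c) (s c) (r c) (t c) (s₁ c)
      (s₂ c) (r₁ c) (r₂ c)) 0 = 0 := by
  refine (DefinablePred.eq (Definable.vis ?_) (.const 0)).not
  refine definable_ofDigits hL (l := [i, q, a, s, r, t, s₁, s₂, r₁, r₂]) ?_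
  simp only [List.forall_mem_cons]
  exact ⟨hi, hq, ha, hs, hr, ht, hs₁, hs₂, hr₁, hr₂, fun _ h => by cases h⟩

theorem definablePred_enter (hL : Definable L) (hq : Definable q) :
    DefinablePred fun c => Enter c.mem (L c) (fun y => ¬ c.vis.getD y 0 = 0) (q c) := by
  have h0 := Definable.const 0
  refine DefinablePred.or ?_ ?_
  · refine DefinablePred.exists_lt definable_lettersAt ?_
    exact definablePred_vis_node hL.tail h0 (definable_leadingStepAt hq.tail .head)
      h0 h0 h0 h0 h0 h0 h0 h0
  · refine DefinablePred.exists_lt definable_lettersAt ?_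
    refine DefinablePred.exists_lt (definable_sizeAt hL.tail hq.tail) ?_
    have hL3 := hL.tail.tail.tail
    have hq3 := hq.tail.tail.tail
    have ha3 := Definable.head.tail.tail
    have hs3 := Definable.head.tail
    have hp3 := definable_leadingStepAt hq3 ha3
    refine DefinablePred.exists_lt
      (definable_sizeAt hL.tail.tail (definable_leadingStepAt hq.tail.tail Definable.head.tail)) ?_
    refine DefinablePred.and (DefinablePred.eq (definable_acceptAt hL3 hq3 hs3)
      (definable_acceptAt hL3 hp3 .head)).not ?_
    exact definablePred_vis_node hL3 (.const 1) hq3 ha3 hs3 .head hp3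
      (definable_stepAt hL3 hq3 (definable_startAt hL3 hq3) ha3)
      (definable_stepAt hL3 hq3 hs3 ha3) (definable_startAt hL3 hp3) .head

theorem definablePred_traverse (hL : Definable L) (hq : Definable q) (ha : Definable a)
    (hs : Definable s) (hr : Definable r) (ht : Definable t) (hs₁ : Definable s₁)
    (hs₂ : Definable s₂) (hr₁ : Definable r₁) (hr₂ : Definable r₂) :
    DefinablePred fun c => Traverse c.mem (L c) (fun y => ¬ c.vis.getD y 0 = 0) (q c) (a c) (s c)
      (r c) (t c) (s₁ c) (s₂ c) (r₁ c) (r₂ c) := by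
  have hp := definable_leadingStepAt hq ha
  refine DefinablePred.or ?_ ?_
  · exact (DefinablePred.eq ht hq).and ((DefinablePred.eq hs₁ hs).and
      ((DefinablePred.eq hs₂ hs).and ((DefinablePred.eq (definable_stepAt hL hp hr₁ ha) hr).and
        (DefinablePred.eq (definable_stepAt hL hp hr₂ ha) hr))))
  · refine DefinablePred.exists_lt definable_lettersAt ?_
    exact definablePred_vis_node hL.tail (.const 1) hq.tail ha.tail hs.tail hr.tail
      (definable_leadingStepAt ht.tail .head) (definable_stepAt hL.tail hq.tail hs₁.tail .head)
      (definable_stepAt hL.tail hq.tail hs₂.tail .head)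
      (definable_stepAt hL.tail hp.tail hr₁.tail .head)
      (definable_stepAt hL.tail hp.tail hr₂.tail .head)

theorem definablePred_search (hL : Definable L) (hx : Definable x) :
    DefinablePred fun c => Search c.mem (L c) (fun y => ¬ c.vis.getD y 0 = 0) (x c) := by
  have hd := fun i => definable_digit hL i hx
  exact ((DefinablePred.eq (hd 0) (.const 0)).and (definablePred_enter hL (hd 1))).or
    ((DefinablePred.eq (hd 0) (.const 1)).and (definablePred_traverse hL (hd 1) (hd 2) (hd 3)
      (hd 4) (hd 5) (hd 6) (hd 7) (hd 8) (hd 9)))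

end definable

end FDWA

/-! ### Correctness of the backward search -/

/-- The iterates of a monotone operator on subsets of a set with `m` elements are contained in the
`m`-th one. -/
theorem Finset.iterate_subset_of_monotone {f : Finset ℕ → Finset ℕ} (hf : Monotone f) {m : ℕ}
    (hm : ∀ X, f X ⊆ Finset.range m) (k : ℕ) : f^[k] ∅ ⊆ f^[m] ∅ := by
  have hmono : Monotone fun n => f^[n] ∅ := hf.monotone_iterate_of_le_map (Finset.empty_subset _)
  -- The iterates increase from `∅`. If the first `m + 1` inclusions were all strict, the last set
  -- would have more than `m` elements.
  have hstab : ∃ j ≤ m, f^[j + 1] ∅ = f^[j] ∅ := by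
    by_contra hne
    push Not at hne
    have hcard : ∀ j ≤ m + 1, j ≤ (f^[j] ∅).card := by
      intro j hj
      induction j with
      | zero => exact Nat.zero_le _
      | succ j ih =>
        have h1 : f^[j] ∅ ⊂ f^[j + 1] ∅ :=
          lt_of_le_of_ne (hmono (Nat.le_succ j)) (hne j (by omega)).symm
        have := Finset.card_lt_card h1
        have := ih (by omega)
        omega
    have h1 := hcard (m + 1) le_rfl
    have h2 : (f^[m + 1] ∅).card ≤ m := by
      rw [Function.iterate_succ_apply']
      exact (Finset.card_le_card (hm _)).trans (by simp)
    omega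
  obtain ⟨j, hj, hfix⟩ := hstab
  rcases le_total k j with h | h
  · exact (hmono h).trans (hmono hj)
  · obtain ⟨i, rfl⟩ : ∃ i, k = i + j := ⟨k - j, by omega⟩
    rw [Function.iterate_succ_apply'] at hfix
    rw [Function.iterate_add_apply, Function.iterate_fixed hfix]
    exact hmono hj

namespace FDWA

open StackProgram

open scoped Classical in
/-- One step of the backward search. -/
noncomputable def backward (M : List ℕ) (L : ℕ) (X : Finset ℕ) : Finset ℕ :=
  (Finset.range (L ^ 10)).filter (Search M L (· ∈ X))

theorem mem_backward {M : List ℕ} {L : ℕ} {X : Finset ℕ} {x : ℕ} :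
    x ∈ backward M L X ↔ x < L ^ 10 ∧ Search M L (· ∈ X) x := by
  classical rw [backward, Finset.mem_filter, Finset.mem_range]

theorem backward_mono (M : List ℕ) (L : ℕ) : Monotone (backward M L) := by
  intro X Y h x hx
  rw [mem_backward] at hx ⊢
  exact ⟨hx.1, hx.2.mono fun y hy => h hy⟩

/-- Ten components below `L` are recovered as digits, and the node lies below `L ^ 10`. -/
theorem node_mem_backward {M : List ℕ} {L : ℕ} (hL : 1 < L) {X : Finset ℕ}
    {i q a s r t s₁ s₂ r₁ r₂ : ℕ} (hi : i < L) (hq : q < L) (ha : a < L) (hs : s < L) (hr : r < L)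
    (ht : t < L) (hs₁ : s₁ < L) (hs₂ : s₂ < L) (hr₁ : r₁ < L) (hr₂ : r₂ < L) :
    node L i q a s r t s₁ s₂ r₁ r₂ ∈ backward M L X ↔ (i = 0 ∧ Enter M L (· ∈ X) q) ∨
      (i = 1 ∧ Traverse M L (· ∈ X) q a s r t s₁ s₂ r₁ r₂) := by
  have hlt : ∀ d ∈ [i, q, a, s, r, t, s₁, s₂, r₁, r₂], d < L := by
    simp only [List.forall_mem_cons]
    exact ⟨hi, hq, ha, hs, hr, ht, hs₁, hs₂, hr₁, hr₂, fun _ h => by cases h⟩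
  have hd := digit_ofDigits hlt
  rw [mem_backward, Search, node, hd, hd, hd, hd, hd, hd, hd, hd, hd, hd]
  exact and_iff_right (Nat.ofDigits_lt_base_pow_length hL hlt)

variable (W : FDWA)

/-- The set of nodes from which the search ends within `k` steps. -/
noncomputable def found (k : ℕ) : Finset ℕ := (backward W.numbers W.encode.length)^[k] ∅

theorem one_lt_length_encode : 1 < W.encode.length :=
  lt_of_le_of_lt W.letters_pos W.letters_lt

theorem leading_lt (q : Fin W.leadingSize) : (q : ℕ) < W.encode.length :=
  q.2.trans W.leadingSize_lt

theorem letter_lt (a : Fin W.letters) : (a : ℕ) < W.encode.length := a.2.trans W.letters_lt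

theorem state_lt {q : Fin W.leadingSize} (s : Fin (W.progressSize q)) :
    (s : ℕ) < W.encode.length := s.2.trans (W.progressSize_lt q)

/-- The node at which a leading state is looked for. -/
noncomputable def leadingNode (q : Fin W.leadingSize) : ℕ :=
  node W.encode.length 0 q 0 0 0 0 0 0 0 0

/-- The nodes at which the period is read. -/
noncomputable def loopNode (q : Fin W.leadingSize) (a : Fin W.letters)
    (s : Fin (W.progressSize q)) (r : Fin (W.progressSize (W.family.leading.step q a)))
    (t : Fin W.leadingSize) (s₁ s₂ : Fin (W.progressSize q))
    (r₁ r₂ : Fin (W.progressSize (W.family.leading.step q a))) : ℕ :=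
  node W.encode.length 1 q a s r t s₁ s₂ r₁ r₂

/-- When the guess of `a`, `s`, `r` is made, the leading system and both copies of the automaton of
`q` read `a` at once. The copies of the other automaton do not, since their word `za` starts after
this letter. -/
theorem leadingNode_mem_found_succ (k : ℕ) (q : Fin W.leadingSize) :
    W.leadingNode q ∈ W.found (k + 1) ↔
      (∃ b, W.leadingNode (W.family.leading.step q b) ∈ W.found k) ∨
      ∃ a s r, ¬ (s ∈ (W.family.progress q).accept ↔
          r ∈ (W.family.progress (W.family.leading.step q a)).accept) ∧
        W.loopNode q a s r (W.family.leading.step q a)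
          ((W.family.progress q).step (W.family.progress q).start a)
          ((W.family.progress q).step s a) (W.family.progress _).start r ∈ W.found k := by
  classical
  have hL := W.one_lt_length_encode
  have hL0 : 0 < W.encode.length := by omega
  rw [found, Function.iterate_succ_apply', ← found, leadingNode, node_mem_backward hL hL0
    (W.leading_lt q) hL0 hL0 hL0 hL0 hL0 hL0 hL0 hL0]
  have hne : ∀ (a : Fin W.letters) (s : Fin (W.progressSize q))
      (r : Fin (W.progressSize (W.family.leading.step q a))),
      (¬ (s ∈ (W.family.progress q).accept ↔
        r ∈ (W.family.progress (W.family.leading.step q a)).accept) ↔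
      ¬ (if s ∈ (W.family.progress q).accept then 1 else 0) =
        if r ∈ (W.family.progress (W.family.leading.step q a)).accept then 1 else 0) := by
    intro a s r
    split_ifs <;> simp [*]
  simp only [true_and, zero_ne_one, false_and, or_false, Enter, lettersAt_numbers]
  refine or_congr ?_ ?_
  · constructor
    · rintro ⟨b, hb, h⟩
      refine ⟨⟨b, hb⟩, ?_⟩
      rw [leadingNode, ← leadingStepAt_numbers]
      exact h
    · rintro ⟨b, h⟩
      refine ⟨b, b.2, ?_⟩
      rw [leadingStepAt_numbers]
      exact h
  · constructor
    · rintro ⟨a, ha, s, hs, r, hr, hacc, h⟩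
      lift a to Fin W.letters using ha
      rw [sizeAt_numbers] at hs
      lift s to Fin (W.progressSize q) using hs
      simp only [leadingStepAt_numbers] at hr hacc h
      rw [sizeAt_numbers] at hr
      lift r to Fin (W.progressSize (W.family.leading.step q a)) using hr
      simp only [acceptAt_numbers, startAt_numbers, stepAt_numbers] at hacc h
      exact ⟨a, s, r, (hne a s r).2 hacc, h⟩
    · rintro ⟨a, s, r, hacc, h⟩
      refine ⟨a, a.2, s, by rw [sizeAt_numbers]; exact s.2, r, ?_⟩
      simp only [leadingStepAt_numbers, sizeAt_numbers, acceptAt_numbers, startAt_numbers,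
        stepAt_numbers]
      exact ⟨r.2, (hne a s r).1 hacc, h⟩

/-- The search may end when `z` has been read; the automaton of the `a`-successor then still has the
last letter `a` of `za` to read. -/
theorem loopNode_mem_found_succ (k : ℕ) (q : Fin W.leadingSize) (a : Fin W.letters)
    (s : Fin (W.progressSize q)) (r : Fin (W.progressSize (W.family.leading.step q a)))
    (t : Fin W.leadingSize) (s₁ s₂ : Fin (W.progressSize q))
    (r₁ r₂ : Fin (W.progressSize (W.family.leading.step q a))) :
    W.loopNode q a s r t s₁ s₂ r₁ r₂ ∈ W.found (k + 1) ↔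
      (t = q ∧ s₁ = s ∧ s₂ = s ∧ (W.family.progress _).step r₁ a = r ∧
        (W.family.progress _).step r₂ a = r) ∨
      ∃ b, W.loopNode q a s r (W.family.leading.step t b) ((W.family.progress q).step s₁ b)
        ((W.family.progress q).step s₂ b) ((W.family.progress _).step r₁ b)
        ((W.family.progress _).step r₂ b) ∈ W.found k := by
  have hL := W.one_lt_length_encode
  rw [found, Function.iterate_succ_apply', ← found, loopNode, node_mem_backward hL hL
    (W.leading_lt q) (W.letter_lt a) (W.state_lt s) (W.state_lt r) (W.leading_lt t)
    (W.state_lt s₁) (W.state_lt s₂) (W.state_lt r₁) (W.state_lt r₂)]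
  simp only [true_and, one_ne_zero, false_and, false_or, Traverse, lettersAt_numbers,
    leadingStepAt_numbers, stepAt_numbers, Fin.val_inj]
  refine or_congr Iff.rfl ?_
  constructor
  · rintro ⟨b, hb, h⟩
    lift b to Fin W.letters using hb
    simp only [leadingStepAt_numbers, stepAt_numbers] at h
    exact ⟨b, h⟩
  · rintro ⟨b, h⟩
    refine ⟨b, b.2, ?_⟩
    simp only [leadingStepAt_numbers, stepAt_numbers]
    exact h

/-- The copy started in the initial state checks that the guessed state is reached in the first
round, and the copy started in the guessed state checks that it loops. The letters chosen by the
search form the word `z`. -/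
theorem exists_loopNode_mem_found (q : Fin W.leadingSize) (a : Fin W.letters)
    (s : Fin (W.progressSize q)) (r : Fin (W.progressSize (W.family.leading.step q a)))
    (t : Fin W.leadingSize) (s₁ s₂ : Fin (W.progressSize q))
    (r₁ r₂ : Fin (W.progressSize (W.family.leading.step q a))) :
    (∃ k, W.loopNode q a s r t s₁ s₂ r₁ r₂ ∈ W.found k) ↔
      ∃ z : List (Fin W.letters), z.foldl W.family.leading.step t = q ∧
        (W.family.progress q).evalFrom s₁ z = s ∧ (W.family.progress q).evalFrom s₂ z = s ∧
        (W.family.progress _).evalFrom r₁ (z ++ [a]) = r ∧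
        (W.family.progress _).evalFrom r₂ (z ++ [a]) = r := by
  constructor
  · rintro ⟨k, hk⟩
    induction k generalizing t s₁ s₂ r₁ r₂ with
    | zero => simp [found] at hk
    | succ k ih =>
      rcases (W.loopNode_mem_found_succ ..).1 hk with h | ⟨b, hb⟩
      · exact ⟨[], h⟩
      · obtain ⟨z, hz⟩ := ih _ _ _ _ _ hb
        exact ⟨b :: z, hz⟩
  · rintro ⟨z, hz⟩
    induction z generalizing t s₁ s₂ r₁ r₂ with
    | nil => exact ⟨1, (W.loopNode_mem_found_succ ..).2 (Or.inl hz)⟩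
    | cons b z ih =>
      obtain ⟨k, hk⟩ := ih _ _ _ _ _ hz
      exact ⟨k + 1, (W.loopNode_mem_found_succ ..).2 (Or.inr ⟨b, hk⟩)⟩

theorem exists_leadingNode_mem_found (q : Fin W.leadingSize) :
    (∃ k, W.leadingNode q ∈ W.found k) ↔
      ∃ u : List (Fin W.letters), W.family.HasUnstableLoop (u.foldl W.family.leading.step q) := by
  constructor
  · rintro ⟨k, hk⟩
    induction k generalizing q with
    | zero => simp [found] at hk
    | succ k ih =>
      rcases (W.leadingNode_mem_found_succ k q).1 hk with ⟨b, hb⟩ | ⟨a, s, r, hne, h⟩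
      · obtain ⟨u, hu⟩ := ih _ hb
        exact ⟨b :: u, hu⟩
      · obtain ⟨z, hz, hs, hss, hr, hrr⟩ := (W.exists_loopNode_mem_found ..).1 ⟨k, h⟩
        exact ⟨[], a, s, r, z, hz, hs, hss, hr, hrr, hne⟩
  · rintro ⟨u, hu⟩
    induction u generalizing q with
    | nil =>
      obtain ⟨a, s, r, z, hz, hs, hss, hr, hrr, hne⟩ := hu
      obtain ⟨k, hk⟩ := (W.exists_loopNode_mem_found ..).2 ⟨z, hz, hs, hss, hr, hrr⟩
      exact ⟨k + 1, (W.leadingNode_mem_found_succ k q).2 (Or.inr ⟨a, s, r, hne, hk⟩)⟩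
    | cons b u ih =>
      obtain ⟨k, hk⟩ := ih _ hu
      exact ⟨k + 1, (W.leadingNode_mem_found_succ k q).2 (Or.inl ⟨b, hk⟩)⟩

/-- All nodes found are below `L ^ 10`, so by monotonicity later iterates find nothing new. -/
theorem saturated_iff : W.Saturated ↔
    W.leadingNode W.family.leading.start ∉ W.found (W.encode.length ^ 10) := by
  rw [Saturated, AutomataFamily.omegaSaturated_iff _ W.weak, ← not_exists, not_iff_not]
  refine (W.exists_leadingNode_mem_found _).symm.trans ⟨fun ⟨k, hk⟩ => ?_, fun h => ⟨_, h⟩⟩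
  exact Finset.iterate_subset_of_monotone (backward_mono _ _)
    (fun X x hx => Finset.mem_range.2 (mem_backward.1 hx).1) k hk

-- The table is the characteristic function of the set found so far. Reads beyond its end give `0`,
-- so the initial empty table represents `∅`, and numbers from `L ^ 10` on are never found.
open scoped Classical in
theorem mem_found_iff {step : Expr} (hstep : ∀ M V E, step.eval M V E =
      if Search M (E.getD 1 0) (fun y => ¬ V.getD y 0 = 0) (E.getD 0 0) then 1 else 0)
    (k y : ℕ) : y ∈ W.found k ↔ ¬ ((step.table (W.encode.length ^ 10) W.encode.length
      W.numbers)^[k] []).getD y 0 = 0 := by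
  induction k generalizing y with
  | zero => simp [found]
  | succ k ih =>
    rw [found, Function.iterate_succ_apply', ← found, Function.iterate_succ_apply',
      mem_backward, funext fun y => propext (ih y)]
    set V := (step.table (W.encode.length ^ 10) W.encode.length W.numbers)^[k] []
    rw [Expr.table]
    by_cases hy : y < W.encode.length ^ 10
    · rw [List.getD_eq_getElem _ _ (by simpa using hy)]
      simp [hstep, hy]
    · rw [List.getD_eq_default _ _ (by simpa using hy)]
      simp [hy]

/-! ### The decision program -/

open scoped Classical in
/-- Some program decides saturation in polynomial time. -/
theorem exists_run : ∃ (p : Prog) (P : Polynomial ℕ), ∀ W : FDWA,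
    Run p { mem := W.numbers } { res := [if W.Saturated then 1 else 0] }
      (P.eval W.encode.length) := by
  -- The exponent is the number of digits of a node.
  obtain ⟨size, hsize⟩ := (Definable.var 0).pow 10
  -- A table entry is computed in the environment `[x, L]`, so variable `1` is the length and
  -- variable `0` the node; in `size` and `final` the length is variable `0`.
  obtain ⟨step, hstep⟩ := definablePred_search (Definable.var 1) (Definable.var 0)
  have h0 := Definable.const 0
  -- Entry `2` of the input is the initial leading state. The negation is there because a node that
  -- is found refutes saturation.
  obtain ⟨final, hfinal⟩ := (definablePred_vis_node (Definable.var 0) h0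
    (Definable.mem (.const 2)) h0 h0 h0 h0 h0 h0 h0 h0).not
  obtain ⟨P, hP⟩ := Run.solve (size := size) (step := step) (final := final) (d := 10)
    (fun M V L => hsize M V [L]) (fun M V E => by rw [hstep]; dsimp only; split_ifs <;> simp)
  refine ⟨.solve size step final, P, fun W => ?_⟩
  have h := hP W.numbers W.encode.length rfl
  rw [hfinal] at h
  convert h using 3
  dsimp only
  congr 1
  rw [W.saturated_iff, W.mem_found_iff hstep]
  rfl

end FDWA

/-- Saturation of a given FDWA is decidable in polynomial time: some Turing machine halts on the
encoding of every FDWA `W` within a number of steps that is polynomial in the length of the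
encoding, and its output bit says whether `W` is saturated. -/
theorem mainTheorem5 :
    ∃ decider : FDWA → Bool,
      (∀ W : FDWA, decider W = true ↔ W.Saturated) ∧
      Nonempty (Turing.TM2ComputableInPolyTime FDWA.encode Computability.encodeBool decider) := by
  classical
  obtain ⟨p, P, hP⟩ := FDWA.exists_run
  refine ⟨fun W => decide W.Saturated, fun W => by simp,
    StackProgram.computableInPolyTime_of_run p FDWA.numbers FDWA.encode_eq_unary P fun W => ?_⟩
  simpa using hP W
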